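/- Let $\tilde{\mathbb C}^2=\{(z,[t])\in\mathbb C^2\times\mathbb CP^1 : t_1z_2=t_2z_1\}$ be the blow-up of $\mathbb C^2$ at the origin, with exceptional divisor $H=\{z=0\}$. The form $\frac{i}{2\pi}\partial\bar\partial(|z|^2+\log|z|^2)$ on $\mathbb C^2\setminus\{0\}\cong\tilde{\mathbb C}^2\setminus H$ extends to a Kähler form $\omega_S$ on $\tilde{\mathbb C}^2$, equal to $\frac{i}{2\pi}\partial\bar\partial\big(|z|^2+\log(1+|t_2/t_1|^2)\big)$ where $t_1\neq0$ and to $\frac{i}{2\pi}\partial\bar\partial\big(|z|^2+\log(1+|t_1/t_2|^2)\big)$ where $t_2\ne0$; the corresponding Kähler metric $g_S$ is the Simanca metric. Then $(\tilde{\mathbb C}^2,g_S)$ admits a regular quantization with $\epsilon_{mg_S}\equiv m^2$ for every integer $m\ge1$. That is, there are a holomorphic line bundle $L\to\tilde{\mathbb C}^2$ with $c_1(L)=[\omega_S]$ and, for every integer $m\ge1$, a Hermitian metric $h_m$ on $L^m=L^{\otimes m}$ with $\mathrm{Ric}(h_m)=m\,\omega_S$, where $\mathrm{Ric}(h_m)=-\frac{i}{2\pi}\partial\bar\partial\log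 h_m(\sigma,\sigma)$ for local trivializing holomorphic sections $\sigma$ of $L^m$, such that the following holds for every $m\ge1$. Let $\mathcal H_m$ be the Hilbert space of global holomorphic sections $s$ of $L^m$ with $\langle s,s\rangle_{h_m}=\int_{\tilde{\mathbb C}^2}h_m(s,s)\,\frac{\omega_S^2}{2!}<\infty$. Then for every orthonormal basis $(s_j)_j$ of $\mathcal H_m$ and every point $x\in\tilde{\mathbb C}^2$, $$\epsilon_{mg_S}(x)=\sum_j h_m(s_j(x),s_j(x))=m^2 .$$ In particular $mg_S$ is balanced (its function $\epsilon_{mg_S}$ is a positive constant) for every $m\ge1$, so that the quantization is regular. -/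

import Mathlib

open scoped Manifold ContDiff Topology LinearAlgebra.Projectivization

noncomputable section

namespace RegularQuantization

/-! ## Forms on complex surfaces

A complex surface is a space `M` with an atlas of charts in `ℂ × ℂ` with holomorphic transition
maps.  As everywhere in Mathlib, the tangent space of `M` at `x` is the model space `ℂ × ℂ`,
identified with the tangent vectors at `x` through the preferred chart `chartAt (ℂ × ℂ) x`. -/

section Forms

/-- A real two-form on `M`, as a function of a point and two tangent vectors at this point. -/
abbrev TwoForm (M : Type*) [TopologicalSpace M] [ChartedSpace (ℂ × ℂ) M] :=
  (x : M) → TangentSpace 𝓘(ℂ, ℂ × ℂ) x → TangentSpace 𝓘(ℂ, ℂ × ℂ) x → ℝ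

/-- A real one-form on `M`. -/
abbrev OneForm (M : Type*) [TopologicalSpace M] [ChartedSpace (ℂ × ℂ) M] :=
  (x : M) → TangentSpace 𝓘(ℝ, ℂ × ℂ) x →L[ℝ] ℝ

/-- The two-form `(i/2π) ∂∂̄F` of a function `F` on `ℂ × ℂ`, at the point `p`, on the vectors `u`,
`v`.  If `L(u, v) = ∑ F_{jk̄} u_j v̄_k` is the Levi form of `F`, then
`(i ∂∂̄F)(u, v) = i (L(u, v) - L(v, u)) = (D²F(iu, v) - D²F(u, iv)) / 2`. -/
def ddbarModel (F : ℂ × ℂ → ℝ) (p u v : ℂ × ℂ) : ℝ :=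
  (1 / (4 * Real.pi)) *
    (fderiv ℝ (fderiv ℝ F) p (Complex.I • u) v - fderiv ℝ (fderiv ℝ F) p u (Complex.I • v))

variable {M : Type*} [TopologicalSpace M] [ChartedSpace (ℂ × ℂ) M]

/-- The two-form `(i/2π) ∂∂̄f` of a function `f` on `M`. -/
def ddbar (f : M → ℝ) : TwoForm M := fun x u v =>
  ddbarModel (f ∘ (chartAt (ℂ × ℂ) x).symm) (chartAt (ℂ × ℂ) x x) u v

/-- `Ω` is a Kähler form: locally it is `(i/2π) ∂∂̄φ` for a smooth function `φ`, and it is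
positive, i.e. `Ω(u, iu) > 0` for every tangent vector `u ≠ 0`.  The Kähler metric is then
`g(u, v) = Ω(u, iv)`. -/
def IsKahlerForm (Ω : TwoForm M) : Prop :=
  (∀ x : M, ∃ U : Set M, IsOpen U ∧ x ∈ U ∧ ∃ φ : M → ℝ,
    ContMDiffOn 𝓘(ℝ, ℂ × ℂ) 𝓘(ℝ, ℝ) ∞ φ U ∧ ∀ y ∈ U, Ω y = ddbar φ y) ∧
  ∀ (x : M) (u : TangentSpace 𝓘(ℂ, ℂ × ℂ) x), u ≠ 0 → 0 < Ω x u (Complex.I • u)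

/-- The coefficients of a one-form in the chart `chartAt (ℂ × ℂ) x`, that is, the pull-back of the
one-form under the inverse of this chart. -/
def OneForm.inChart (η : OneForm M) (x : M) (w : ℂ × ℂ) : ℂ × ℂ →L[ℝ] ℝ :=
  let y : M := (chartAt (ℂ × ℂ) x).symm w
  ContinuousLinearMap.comp (η y : ℂ × ℂ →L[ℝ] ℝ)
    (fderiv ℝ (chartAt (ℂ × ℂ) y ∘ (chartAt (ℂ × ℂ) x).symm) w)

/-- Smoothness of a one-form. -/
def OneForm.IsSmooth (η : OneForm M) : Prop :=
  ∀ x : M, ContDiffOn ℝ ∞ (η.inChart x) (chartAt (ℂ × ℂ) x).target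

/-- The exterior derivative of a one-form. -/
def OneForm.d (η : OneForm M) : TwoForm M := fun x u v =>
  fderiv ℝ (η.inChart x) (chartAt (ℂ × ℂ) x x) u v -
    fderiv ℝ (η.inChart x) (chartAt (ℂ × ℂ) x x) v u

/-- The density, with respect to the Lebesgue measure of the model space, of `Ω ∧ Ω / 2!` at `x`:
the value of this four-form on the standard oriented real basis `e₁, i e₁, e₂, i e₂`. -/
def volumeDensity (Ω : TwoForm M) (x : M) : ℝ :=
  let a : TangentSpace 𝓘(ℂ, ℂ × ℂ) x := ((1, 0) : ℂ × ℂ)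
  let b : TangentSpace 𝓘(ℂ, ℂ × ℂ) x := ((Complex.I, 0) : ℂ × ℂ)
  let c : TangentSpace 𝓘(ℂ, ℂ × ℂ) x := ((0, 1) : ℂ × ℂ)
  let d : TangentSpace 𝓘(ℂ, ℂ × ℂ) x := ((0, Complex.I) : ℂ × ℂ)
  Ω x a b * Ω x c d - Ω x a c * Ω x b d + Ω x a d * Ω x b c

/-- The measure on `M` defined by the volume form `Ω ∧ Ω / 2!`.  The surface is the disjoint union
of the sets of points with a given preferred chart `e`; on each of them the measure is given, in
the coordinates `e`, by the density of `Ω ∧ Ω / 2!` in these coordinates. -/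
def volumeMeasure [MeasurableSpace M] (Ω : TwoForm M) : MeasureTheory.Measure M :=
  MeasureTheory.Measure.sum fun e : atlas (ℂ × ℂ) M =>
    MeasureTheory.Measure.map e.1.symm
      ((MeasureTheory.volume.restrict
        {w | w ∈ e.1.target ∧ chartAt (ℂ × ℂ) (e.1.symm w) = e.1}).withDensity
          fun w => ENNReal.ofReal (volumeDensity Ω (e.1.symm w)))

end Forms

/-! ## Holomorphic line bundles and quantizations -/

/-- A holomorphic line bundle on `M`, given by a trivializing open cover and holomorphic
transition functions. -/
structure HolomorphicLineBundle (M : Type*) [TopologicalSpace M] [ChartedSpace (ℂ × ℂ) M] where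
  /-- The index set of the cover. -/
  ι : Type
  /-- The cover, the transition functions and the resulting bundle. -/
  core : VectorBundleCore ℂ M ℂ ι
  /-- The transition functions are holomorphic. -/
  holomorphic : core.IsContMDiff 𝓘(ℂ, ℂ × ℂ) ω

section Bundles

variable {M : Type*} [TopologicalSpace M] [ChartedSpace (ℂ × ℂ) M]

namespace HolomorphicLineBundle

/-- The fibre of the line bundle over `x`. -/
abbrev Fiber (L : HolomorphicLineBundle M) (x : M) : Type := L.core.Fiber x

/-- Global holomorphic sections. -/
abbrev HolomorphicSection (L : HolomorphicLineBundle M) : Type _ :=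
  ContMDiffSection 𝓘(ℂ, ℂ × ℂ) ℂ ω L.core.Fiber

/-- The trivializing holomorphic section over the `i`-th set of the cover. -/
def frame (L : HolomorphicLineBundle M) (i : L.ι) (x : M) : L.Fiber x :=
  (L.core.localTriv i).symm x (1 : ℂ)

/-- The tensor power `L^m`: its transition functions are the `m`-th powers of those of `L`. -/
def pow (L : HolomorphicLineBundle M) (m : ℕ) : HolomorphicLineBundle M where
  ι := L.ι
  core :=
    { baseSet := L.core.baseSet
      isOpen_baseSet := L.core.isOpen_baseSet
      indexAt := L.core.indexAt
      mem_baseSet_at := L.core.mem_baseSet_at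
      coordChange := fun i j x => (L.core.coordChange i j x 1) ^ m • ContinuousLinearMap.id ℂ ℂ
      coordChange_self := by
        intro i x hx v
        simp [L.core.coordChange_self i x hx]
      continuousOn_coordChange := by
        intro i j
        have h := (L.core.continuousOn_coordChange i j).clm_apply
          (continuousOn_const (c := (1 : ℂ)))
        exact (h.pow m).smul continuousOn_const
      coordChange_comp := by
        intro i j k x hx v
        have h := L.core.coordChange_comp i j k x hx 1
        have h2 : L.core.coordChange j k x (L.core.coordChange i j x 1) =
            L.core.coordChange i j x 1 * L.core.coordChange j k x 1 := by
          conv_lhs => rw [← mul_one (L.core.coordChange i j x 1), ← smul_eq_mul, map_smul]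
          rfl
        rw [h2] at h
        simp only [smul_apply, ContinuousLinearMap.id_apply, smul_eq_mul, ← h]
        ring }
  holomorphic := by
    refine ⟨fun i j => ?_⟩
    have h := L.holomorphic.contMDiffOn_coordChange i j
    have h1 : ContMDiffOn 𝓘(ℂ, ℂ × ℂ) 𝓘(ℂ, ℂ) ω (fun x => L.core.coordChange i j x 1)
        (L.core.baseSet i ∩ L.core.baseSet j) := h.clm_apply contMDiffOn_const
    exact (h1.pow m).smul contMDiffOn_const

end HolomorphicLineBundle

/-- A smooth Hermitian metric on a holomorphic line bundle. -/
structure HermitianMetric (L : HolomorphicLineBundle M) where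
  /-- The Hermitian form on each fibre, conjugate-linear in the first variable. -/
  form : (x : M) → L.Fiber x →ₗ⋆[ℂ] L.Fiber x →ₗ[ℂ] ℂ
  conj_symm : ∀ (x : M) (v w : L.Fiber x), (starRingEnd ℂ) (form x v w) = form x w v
  pos : ∀ (x : M) (v : L.Fiber x), v ≠ 0 → 0 < (form x v v).re
  smooth : ∀ i : L.ι, ContMDiffOn 𝓘(ℝ, ℂ × ℂ) 𝓘(ℝ, ℝ) ∞
    (fun x => (form x (L.frame i x) (L.frame i x)).re) (L.core.baseSet i)

namespace HermitianMetric

variable {L : HolomorphicLineBundle M}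

/-- The squared length `h(v, v)`. -/
def sq (h : HermitianMetric L) {x : M} (v : L.Fiber x) : ℝ := (h.form x v v).re

/-- The curvature form `Ric(h) = -(i/2π) ∂∂̄ log h(σ, σ)`, where `σ` is a trivializing holomorphic
section near the given point (the form does not depend on this section). -/
def ricci (h : HermitianMetric L) : TwoForm M := fun x u v =>
  -ddbar (fun y => Real.log (h.sq (L.frame (L.core.indexAt x) y))) x u v

variable [MeasurableSpace M]

/-- The squared norm `∫ h(s(x), s(x)) dμ(x)` of a holomorphic section, possibly infinite. -/
def sqNorm (h : HermitianMetric L) (μ : MeasureTheory.Measure M) (s : L.HolomorphicSection) :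
    ENNReal :=
  ∫⁻ x, ENNReal.ofReal (h.sq (s x)) ∂μ

/-- The `L²` scalar product of two holomorphic sections. -/
def scalarProduct (h : HermitianMetric L) (μ : MeasureTheory.Measure M)
    (s t : L.HolomorphicSection) : ℂ :=
  ∫ x, h.form x (s x) (t x) ∂μ

/-- The family `s` is an orthonormal basis of the Hilbert space of all holomorphic sections of
finite norm: it is orthonormal, and its linear span is dense. -/
structure IsOrthonormalBasis (h : HermitianMetric L) (μ : MeasureTheory.Measure M) {J : Type}
    (s : J → L.HolomorphicSection) : Prop where
  sqNorm_lt_top : ∀ j, h.sqNorm μ (s j) < ⊤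
  normalized : ∀ j, h.scalarProduct μ (s j) (s j) = 1
  orthogonal : ∀ j k, j ≠ k → h.scalarProduct μ (s j) (s k) = 0
  dense : ∀ t : L.HolomorphicSection, h.sqNorm μ t < ⊤ → ∀ δ : ENNReal, 0 < δ →
    ∃ u ∈ Submodule.span ℂ (Set.range s), h.sqNorm μ (t - u) < δ

end HermitianMetric

/-- The first Chern class of `L` is the de Rham class of the closed form `Ω`: the curvature form of
a Hermitian metric on `L`, which represents `c₁(L)`, differs from `Ω` by an exact form. -/
def FirstChernClassEq (L : HolomorphicLineBundle M) (Ω : TwoForm M) : Prop :=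
  ∃ (h : HermitianMetric L) (η : OneForm M), η.IsSmooth ∧
    ∀ x u v, h.ricci x u v - Ω x u v = η.d x u v

/-- A geometric quantization of `(M, Ω)`: a holomorphic line bundle `L` with `c₁(L) = [Ω]` and, for
every `m ≥ 1`, a Hermitian metric `h_m` on `L^m` with `Ric(h_m) = m Ω`. -/
structure GeometricQuantization (Ω : TwoForm M) where
  L : HolomorphicLineBundle M
  chern : FirstChernClassEq L Ω
  h : (m : ℕ) → HermitianMetric (L.pow m)
  ricci_eq : ∀ m : ℕ, 1 ≤ m → ∀ x u v, (h m).ricci x u v = m * Ω x u v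

namespace GeometricQuantization

variable [MeasurableSpace M] {Ω : TwoForm M}

/-- Rawnsley's function of `m g` is `ε`: the Hilbert space of holomorphic sections `s` of `L^m` with
`∫ h_m(s, s) Ω² / 2! < ∞` has an orthonormal basis, and for every orthonormal basis `(s_j)` one has
`ε(x) = ∑ h_m(s_j(x), s_j(x))` at every point `x`. -/
def HasEpsilonFunction (Q : GeometricQuantization Ω) (m : ℕ) (ε : M → ℝ) : Prop :=
  (∃ (J : Type) (s : J → (Q.L.pow m).HolomorphicSection),
    (Q.h m).IsOrthonormalBasis (volumeMeasure Ω) s) ∧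
  ∀ (J : Type) (s : J → (Q.L.pow m).HolomorphicSection),
    (Q.h m).IsOrthonormalBasis (volumeMeasure Ω) s →
      ∀ x : M, HasSum (fun j => (Q.h m).sq (s j x)) (ε x)

/-- The metric `m g` is balanced: its Rawnsley function is a positive constant. -/
def IsBalanced (Q : GeometricQuantization Ω) (m : ℕ) : Prop :=
  ∃ c : ℝ, 0 < c ∧ Q.HasEpsilonFunction m fun _ => c

/-- The quantization is regular: `m g` is balanced for all sufficiently large `m`. -/
def IsRegular (Q : GeometricQuantization Ω) : Prop :=
  ∃ m₀ : ℕ, ∀ m : ℕ, m₀ ≤ m → 1 ≤ m → Q.IsBalanced m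

end GeometricQuantization

end Bundles

/-! ## The blow-up of `ℂ²` at the origin -/

/-- The quotient topology on the complex projective line. -/
instance : TopologicalSpace (ℙ ℂ (ℂ × ℂ)) :=
  inferInstanceAs (TopologicalSpace (Quotient (projectivizationSetoid ℂ (ℂ × ℂ))))

/-- The blow-up `{(z, [t]) ∈ ℂ² × ℂP¹ : t₁ z₂ = t₂ z₁}` of `ℂ²` at the origin. -/
def BlowUp : Type :=
  {p : (ℂ × ℂ) × ℙ ℂ (ℂ × ℂ) // p.2.rep.1 * p.1.2 = p.2.rep.2 * p.1.1}

namespace BlowUp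

/-- The topology induced from `ℂ² × ℂP¹`. -/
instance : TopologicalSpace BlowUp :=
  inferInstanceAs (TopologicalSpace
    {p : (ℂ × ℂ) × ℙ ℂ (ℂ × ℂ) // p.2.rep.1 * p.1.2 = p.2.rep.2 * p.1.1})

/-- The point `z` under `(z, [t])`. -/
def z (x : BlowUp) : ℂ × ℂ := x.1.1

/-- A representative `t` of `[t]` in `(z, [t])`. -/
def t (x : BlowUp) : ℂ × ℂ := x.1.2.rep

lemma t_ne_zero (x : BlowUp) : x.t ≠ 0 := x.1.2.rep_nonzero

lemma incidence (x : BlowUp) : x.t.1 * x.z.2 = x.t.2 * x.z.1 := x.2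

lemma exists_rep_mk (v : ℂ × ℂ) (hv : v ≠ 0) :
    ∃ a : ℂ, a ≠ 0 ∧ (Projectivization.mk ℂ v hv).rep = (a * v.1, a * v.2) := by
  obtain ⟨a, ha⟩ := Projectivization.exists_smul_eq_mk_rep ℂ v hv
  exact ⟨a, a.ne_zero, ha.symm⟩

/-- The parametrization `(w₁, w₂) ↦ (w₁, w₁ w₂, [1, w₂])`. -/
def param₁ (w : ℂ × ℂ) : BlowUp :=
  ⟨((w.1, w.1 * w.2), Projectivization.mk ℂ ((1 : ℂ), w.2) (by simp)), by
    obtain ⟨a, _, h⟩ := exists_rep_mk ((1 : ℂ), w.2) (by simp)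
    simp only [h]; ring⟩

/-- The parametrization `(w₁, w₂) ↦ (w₁ w₂, w₂, [w₁, 1])`. -/
def param₂ (w : ℂ × ℂ) : BlowUp :=
  ⟨((w.1 * w.2, w.2), Projectivization.mk ℂ (w.1, (1 : ℂ)) (by simp)), by
    obtain ⟨a, _, h⟩ := exists_rep_mk (w.1, (1 : ℂ)) (by simp)
    simp only [h]; ring⟩

lemma isOpen_and_continuousOn (U : Set (ℂ × ℂ)) (hU : IsOpen U) (q : ℂ × ℂ → ℂ)
    (hq : ContinuousOn q U)
    (hUs : ∀ (a : ℂ) (v : ℂ × ℂ), a ≠ 0 → ((a * v.1, a * v.2) ∈ U ↔ v ∈ U))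
    (hqs : ∀ (a : ℂ) (v : ℂ × ℂ), a ≠ 0 → q (a * v.1, a * v.2) = q v) :
    IsOpen {x : BlowUp | x.t ∈ U} ∧ ContinuousOn (fun x : BlowUp => q x.t) {x | x.t ∈ U} := by
  have hsnd : Continuous fun x : BlowUp => x.1.2 := continuous_snd.comp continuous_subtype_val
  have key : ∀ V : Set ℂ, IsOpen V → IsOpen {p : ℙ ℂ (ℂ × ℂ) | p.rep ∈ U ∩ q ⁻¹' V} := by
    intro V hV
    have hW : IsOpen (U ∩ q ⁻¹' V) := hq.isOpen_inter_preimage hU hV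
    refine isOpen_coinduced.mpr ?_
    convert hW.preimage (continuous_subtype_val (p := fun v : ℂ × ℂ => v ≠ 0)) using 1
    ext ⟨v, hv⟩
    obtain ⟨a, ha, h⟩ := exists_rep_mk v hv
    change (Projectivization.mk ℂ v hv).rep ∈ U ∩ q ⁻¹' V ↔ v ∈ U ∩ q ⁻¹' V
    rw [h]
    simp only [Set.mem_inter_iff, Set.mem_preimage, hUs a v ha, hqs a v ha]
  have hopen : IsOpen {x : BlowUp | x.t ∈ U} := by
    have := (key Set.univ isOpen_univ).preimage hsnd
    simpa [t] using this
  refine ⟨hopen, (continuousOn_open_iff hopen).mpr fun V hV => ?_⟩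
  exact (key V hV).preimage hsnd

lemma continuous_mk {f : ℂ × ℂ → ℂ × ℂ} (hf : Continuous f) (h0 : ∀ w, f w ≠ 0) :
    Continuous fun w => Projectivization.mk ℂ (f w) (h0 w) :=
  continuous_quotient_mk'.comp (hf.subtype_mk h0)

lemma continuous_param₁ : Continuous param₁ := by
  refine Continuous.subtype_mk (Continuous.prodMk (by fun_prop) ?_) _
  exact continuous_mk (f := fun w => ((1 : ℂ), w.2)) (by fun_prop) (by simp)

lemma continuous_param₂ : Continuous param₂ := by
  refine Continuous.subtype_mk (Continuous.prodMk (by fun_prop) ?_) _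
  exact continuous_mk (f := fun w => (w.1, (1 : ℂ))) (by fun_prop) (by simp)

lemma continuous_z : Continuous z := continuous_fst.comp continuous_subtype_val

lemma t_param₁ (w : ℂ × ℂ) : ∃ a : ℂ, a ≠ 0 ∧ (param₁ w).t = (a, a * w.2) := by
  obtain ⟨a, ha, h⟩ := exists_rep_mk ((1 : ℂ), w.2) (by simp)
  exact ⟨a, ha, h.trans (by simp)⟩

lemma t_param₂ (w : ℂ × ℂ) : ∃ a : ℂ, a ≠ 0 ∧ (param₂ w).t = (a * w.1, a) := by
  obtain ⟨a, ha, h⟩ := exists_rep_mk (w.1, (1 : ℂ)) (by simp)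
  exact ⟨a, ha, h.trans (by simp)⟩

lemma ext' {x y : BlowUp} (hz : x.z = y.z) (ht : ∃ a : ℂ, a ≠ 0 ∧ y.t = (a * x.t.1, a * x.t.2)) :
    x = y := by
  obtain ⟨a, ha, h⟩ := ht
  refine Subtype.ext (Prod.ext hz ?_)
  rw [← Projectivization.mk_rep x.1.2, ← Projectivization.mk_rep y.1.2, eq_comm,
    Projectivization.mk_eq_mk_iff']
  exact ⟨a, h.symm⟩

/-- The chart `(z, [t]) ↦ (z₁, t₂ / t₁)` on the open set `t₁ ≠ 0`. -/
def chart₁ : OpenPartialHomeomorph BlowUp (ℂ × ℂ) where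
  toFun x := (x.z.1, x.t.2 / x.t.1)
  invFun := param₁
  source := {x | x.t.1 ≠ 0}
  target := Set.univ
  map_source' _ _ := Set.mem_univ _
  map_target' w _ := by
    obtain ⟨a, ha, h⟩ := t_param₁ w
    simp [h, ha]
  left_inv' x hx := by
    obtain ⟨a, ha, h⟩ := t_param₁ (x.z.1, x.t.2 / x.t.1)
    have hx' : x.t.1 ≠ 0 := hx
    refine ext' (Prod.ext rfl ?_) ⟨x.t.1 / a, div_ne_zero hx' ha, ?_⟩
    · change x.z.1 * (x.t.2 / x.t.1) = x.z.2
      field_simp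
      linear_combination -x.incidence
    · rw [h]
      ext <;> field_simp
  right_inv' w _ := by
    obtain ⟨a, ha, h⟩ := t_param₁ w
    refine Prod.ext rfl ?_
    simp only [h]
    field_simp
  open_source :=
    (isOpen_and_continuousOn {v | v.1 ≠ 0} (isOpen_ne_fun continuous_fst continuous_const)
      (fun v => v.2 / v.1) (continuousOn_snd.div continuousOn_fst fun _ h => h)
      (fun a v ha => by simp [ha]) (fun a v ha => by simp [mul_div_mul_left, ha])).1
  open_target := isOpen_univ
  continuousOn_toFun := by
    refine ContinuousOn.prodMk (continuous_fst.comp continuous_z).continuousOn ?_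
    exact (isOpen_and_continuousOn {v | v.1 ≠ 0} (isOpen_ne_fun continuous_fst continuous_const)
      (fun v => v.2 / v.1) (continuousOn_snd.div continuousOn_fst fun _ h => h)
      (fun a v ha => by simp [ha]) (fun a v ha => by simp [mul_div_mul_left, ha])).2
  continuousOn_invFun := continuous_param₁.continuousOn

/-- The chart `(z, [t]) ↦ (t₁ / t₂, z₂)` on the open set `t₂ ≠ 0`. -/
def chart₂ : OpenPartialHomeomorph BlowUp (ℂ × ℂ) where
  toFun x := (x.t.1 / x.t.2, x.z.2)
  invFun := param₂
  source := {x | x.t.2 ≠ 0}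
  target := Set.univ
  map_source' _ _ := Set.mem_univ _
  map_target' w _ := by
    obtain ⟨a, ha, h⟩ := t_param₂ w
    simp [h, ha]
  left_inv' x hx := by
    obtain ⟨a, ha, h⟩ := t_param₂ (x.t.1 / x.t.2, x.z.2)
    have hx' : x.t.2 ≠ 0 := hx
    refine ext' (Prod.ext ?_ rfl) ⟨x.t.2 / a, div_ne_zero hx' ha, ?_⟩
    · change x.t.1 / x.t.2 * x.z.2 = x.z.1
      field_simp
      linear_combination x.incidence
    · rw [h]
      ext <;> field_simp
  right_inv' w _ := by
    obtain ⟨a, ha, h⟩ := t_param₂ w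
    refine Prod.ext ?_ rfl
    simp only [h]
    field_simp
  open_source :=
    (isOpen_and_continuousOn {v | v.2 ≠ 0} (isOpen_ne_fun continuous_snd continuous_const)
      (fun v => v.1 / v.2) (continuousOn_fst.div continuousOn_snd fun _ h => h)
      (fun a v ha => by simp [ha]) (fun a v ha => by simp [mul_div_mul_left, ha])).1
  open_target := isOpen_univ
  continuousOn_toFun := by
    refine ContinuousOn.prodMk ?_ (continuous_snd.comp continuous_z).continuousOn
    exact (isOpen_and_continuousOn {v | v.2 ≠ 0} (isOpen_ne_fun continuous_snd continuous_const)
      (fun v => v.1 / v.2) (continuousOn_fst.div continuousOn_snd fun _ h => h)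
      (fun a v ha => by simp [ha]) (fun a v ha => by simp [mul_div_mul_left, ha])).2
  continuousOn_invFun := continuous_param₂.continuousOn

open scoped Classical in
/-- The atlas formed by the two charts. -/
instance : ChartedSpace (ℂ × ℂ) BlowUp where
  atlas := {chart₁, chart₂}
  chartAt x := if x.t.1 ≠ 0 then chart₁ else chart₂
  mem_chart_source x := by
    by_cases h : x.t.1 = 0
    · have h2 : x.t.2 ≠ 0 := fun h2 => x.t_ne_zero (Prod.ext h h2)
      rw [if_neg (not_not.mpr h)]
      exact h2
    · rw [if_pos h]
      exact h
  chart_mem_atlas x := by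
    by_cases h : x.t.1 = 0 <;> simp [h]

/-- The blow-up is a complex manifold. -/
instance : IsManifold 𝓘(ℂ, ℂ × ℂ) ω BlowUp := by
  have h12 : ContDiffOn ℂ ω (chart₂ ∘ chart₁.symm) {w | w.2 ≠ 0} := by
    have h : ContDiffOn ℂ ω (fun w : ℂ × ℂ => (w.2⁻¹, w.1 * w.2)) {w | w.2 ≠ 0} :=
      (contDiff_snd.contDiffOn.inv fun _ hw => hw).prodMk
        (contDiff_fst.mul contDiff_snd).contDiffOn
    refine h.congr fun w hw => ?_
    obtain ⟨a, ha, ht⟩ := t_param₁ w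
    have hw' : w.2 ≠ 0 := hw
    change ((param₁ w).t.1 / (param₁ w).t.2, w.1 * w.2) = _
    rw [ht]
    refine Prod.ext ?_ rfl
    simp only
    field_simp
  have h21 : ContDiffOn ℂ ω (chart₁ ∘ chart₂.symm) {w | w.1 ≠ 0} := by
    have h : ContDiffOn ℂ ω (fun w : ℂ × ℂ => (w.1 * w.2, w.1⁻¹)) {w | w.1 ≠ 0} :=
      (contDiff_fst.mul contDiff_snd).contDiffOn.prodMk
        (contDiff_fst.contDiffOn.inv fun _ hw => hw)
    refine h.congr fun w hw => ?_
    obtain ⟨a, ha, ht⟩ := t_param₂ w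
    have hw' : w.1 ≠ 0 := hw
    change (w.1 * w.2, (param₂ w).t.2 / (param₂ w).t.1) = _
    rw [ht]
    refine Prod.ext rfl ?_
    simp only
    field_simp
  refine isManifold_of_contDiffOn _ _ _ ?_
  rintro e e' (rfl | rfl) (rfl | rfl)
  · refine contDiffOn_id.congr fun w hw => ?_
    exact chart₁.right_inv (Set.mem_univ w)
  · refine h12.mono fun w hw => ?_
    have hw' : (param₁ w).t.2 ≠ 0 := hw.1.2
    obtain ⟨a, ha, ht⟩ := t_param₁ w
    rw [ht] at hw'
    exact right_ne_zero_of_mul hw'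
  · refine h21.mono fun w hw => ?_
    have hw' : (param₂ w).t.1 ≠ 0 := hw.1.2
    obtain ⟨a, ha, ht⟩ := t_param₂ w
    rw [ht] at hw'
    exact right_ne_zero_of_mul hw'
  · refine contDiffOn_id.congr fun w hw => ?_
    exact chart₂.right_inv (Set.mem_univ w)

instance : MeasurableSpace BlowUp := borel BlowUp

instance : BorelSpace BlowUp := ⟨rfl⟩

end BlowUp

/-! ## The Simanca metric -/

/-- The square `|z|² = |z₁|² + |z₂|²` of the Euclidean norm, as a function on the blow-up. -/
def normSqZ (x : BlowUp) : ℝ := Complex.normSq x.z.1 + Complex.normSq x.z.2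

open scoped Classical in
/-- The Kähler form `ω_S` of the Simanca metric: it is `(i/2π) ∂∂̄(|z|² + log(1 + |t₂/t₁|²))` where
`t₁ ≠ 0` and `(i/2π) ∂∂̄(|z|² + log(1 + |t₁/t₂|²))` where `t₂ ≠ 0`.  This is the
extension to the blow-up of the form `(i/2π) ∂∂̄(|z|² + log |z|²)` on `ℂ² ∖ {0}`. -/
def simancaForm : TwoForm BlowUp := fun x =>
  if x.t.1 ≠ 0 then
    ddbar (fun y : BlowUp => normSqZ y + Real.log (1 + Complex.normSq (y.t.2 / y.t.1))) x
  else
    ddbar (fun y : BlowUp => normSqZ y + Real.log (1 + Complex.normSq (y.t.1 / y.t.2))) x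

end RegularQuantization

end

/-!
On the blow-up, let `L = 𝒪(1)` be the pull-back of the hyperplane bundle of `ℂP¹`; its frames over
`t₁ ≠ 0` and `t₂ ≠ 0` are `t₁` and `t₂`.  The metric `h(tᵢ, tᵢ) = e^{-|z|²} |tᵢ|² / |t|²` has
`-log h(tᵢ, tᵢ)` equal to the potential of `ω_S` over `tᵢ ≠ 0`, so its curvature is `ω_S`, and
`h_m = hᵐ` has curvature `m ω_S`.  The different local formulas for `ω_S` agree because
`log |ℓ|²` is pluriharmonic for holomorphic `ℓ` without zeros (`ddbarModel_potential_add_log`).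

In the chart `(a, b) ↦ (a, a b, [1, b])`, whose complement is a null set, a section of `𝒪(m)` is an
entire function `f(a, b)`, and holomorphy in the other chart means that the coefficient of `aˡ bᵏ`
vanishes unless `k ≤ l + m` (`coeff_eq_zero`).  Only the monomials with `k ≤ l + m` occur.  The
volume form is `π⁻² (|a|² + 1 / (1 + |b|²))` times Lebesgue measure, and Gamma and Beta integrals
give `‖aˡ bᵏ‖² = l! k! (l + m - k)! / ((l + m)! m^{l + 2})` (`lintegral_monomial`).  The weighted
measure is invariant under rotations of `a` and of `b`, so by Cauchy's formula the scalar product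
of `aˡ bᵏ` with a section is its Taylor coefficient times `‖aˡ bᵏ‖²`
(`integral_conj_monomial_mul`).

Consequently evaluation at a point `x` is the scalar product with the `L²` function
`κ = ∑ conj(e_α(x)) e_α`, where `e_α` are the normalized monomials (`exists_kernel`).  Parseval's
identity for an arbitrary orthonormal basis `(s_j)` says `∑ |s_j(x)|² = ‖κ‖²`, so the sum does not
depend on the basis (`hasSum_norm_eval_sq`), and for the monomials it is computed by the binomial
theorem and the exponential series: it equals `m² / h_m` (`hasSum_normSq_eval_div`).
-/

noncomputable section

namespace RegularQuantization

/-! ### Calculus of `∂∂̄` in `ℂ²` -/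

lemma fderiv_fderiv_apply_eq {F : ℂ × ℂ → ℝ} {p u v : ℂ × ℂ} (hF : ContDiffAt ℝ 2 F p)
    {G : ℂ × ℂ → ℝ} {c : ℝ}
    (hG : ∀ᶠ q in 𝓝 p, HasDerivAt (fun s : ℝ => F (q + s • v)) (G q) 0)
    (hc : HasDerivAt (fun s : ℝ => G (p + s • u)) c 0) :
    fderiv ℝ (fderiv ℝ F) p u v = c := by
  have hd : DifferentiableAt ℝ (fderiv ℝ F) p :=
    (hF.fderiv_right (m := 1) (by norm_num)).differentiableAt (by norm_num)
  have hline : Filter.Tendsto (fun s : ℝ => p + s • u) (𝓝 0) (𝓝 p) := by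
    have : Continuous fun s : ℝ => p + s • u := by fun_prop
    simpa using this.tendsto 0
  have hev : ∀ᶠ q in 𝓝 p, fderiv ℝ F q v = G q := by
    filter_upwards [hG, hF.eventually (by simp)] with q hq hFq
    have h1 := (hFq.differentiableAt (by norm_num)).hasFDerivAt.hasLineDerivAt v
    exact h1.unique hq
  have h2 : HasDerivAt (fun s : ℝ => fderiv ℝ F (p + s • u) v) (fderiv ℝ (fderiv ℝ F) p u v) 0 := by
    have h3 := hd.hasFDerivAt.hasLineDerivAt u
    exact (ContinuousLinearMap.apply ℝ ℝ v).hasFDerivAt.comp_hasDerivAt 0 h3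
  refine h2.unique (hc.congr_of_eventuallyEq ?_)
  exact hline.eventually hev

lemma ddbarModel_congr {F G : ℂ × ℂ → ℝ} {p : ℂ × ℂ} (h : F =ᶠ[𝓝 p] G) (u v : ℂ × ℂ) :
    ddbarModel F p u v = ddbarModel G p u v := by
  unfold ddbarModel
  rw [h.fderiv.fderiv_eq]

lemma ddbarModel_add {F G : ℂ × ℂ → ℝ} {p : ℂ × ℂ} (hF : ContDiffAt ℝ 2 F p)
    (hG : ContDiffAt ℝ 2 G p) (u v : ℂ × ℂ) :
    ddbarModel (fun q => F q + G q) p u v = ddbarModel F p u v + ddbarModel G p u v := by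
  have hev : fderiv ℝ (fun q => F q + G q) =ᶠ[𝓝 p] fun q => fderiv ℝ F q + fderiv ℝ G q := by
    filter_upwards [hF.eventually (by simp), hG.eventually (by simp)] with q h1 h2
    exact fderiv_fun_add (h1.differentiableAt (by norm_num)) (h2.differentiableAt (by norm_num))
  have h1 : DifferentiableAt ℝ (fderiv ℝ F) p :=
    (hF.fderiv_right (m := 1) (by norm_num)).differentiableAt (by norm_num)
  have h2 : DifferentiableAt ℝ (fderiv ℝ G) p :=
    (hG.fderiv_right (m := 1) (by norm_num)).differentiableAt (by norm_num)
  unfold ddbarModel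
  rw [hev.fderiv_eq, fderiv_fun_add h1 h2]
  simp only [add_apply]
  ring

lemma ddbarModel_const_mul (c : ℝ) (F : ℂ × ℂ → ℝ) (p u v : ℂ × ℂ) :
    ddbarModel (fun q => c * F q) p u v = c * ddbarModel F p u v := by
  have h : fderiv ℝ (fun q => c * F q) = c • fderiv ℝ F := by
    have := fderiv_const_smul_field (𝕜 := ℝ) (f := F) c
    simpa [Pi.smul_def, smul_eq_mul] using this
  unfold ddbarModel
  have h2 : fderiv ℝ (c • fderiv ℝ F) p = c • fderiv ℝ (fderiv ℝ F) p :=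
    congrFun (fderiv_const_smul_field (𝕜 := ℝ) (f := fderiv ℝ F) c) p
  rw [h, h2]
  simp only [smul_apply, smul_eq_mul]
  ring

lemma contDiff_normSq {n : ℕ∞ω} : ContDiff ℝ n Complex.normSq := by
  have : (Complex.normSq : ℂ → ℝ) = fun z => ‖z‖ ^ 2 := by
    ext z; exact Complex.normSq_eq_norm_sq z
  show ContDiff ℝ n (fun z => Complex.normSq z)
  simp only [Complex.normSq_eq_norm_sq]
  exact contDiff_id.norm_sq ℝ

lemma hasDerivAt_normSq {f : ℝ → ℂ} {f' : ℂ} {s : ℝ} (hf : HasDerivAt f f' s) :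
    HasDerivAt (fun s => Complex.normSq (f s)) (2 * ((starRingEnd ℂ) (f s) * f').re) s := by
  have h1 := hf.norm_sq
  simp only [Complex.normSq_eq_norm_sq]
  convert h1 using 2
  simp [Complex.mul_re]
  ring

open Complex in
/-- For holomorphic `g`, the form `(i/2π) ∂∂̄|g|²` is the pull-back of the standard form on `ℂ`.
The first and second derivatives of `g` in the directions `v`, and `u` and `v`, are `g₁ v` and `g₂ u v`;
holomorphy enters as their complex linearity. -/
lemma ddbarModel_normSq_comp {g : ℂ × ℂ → ℂ} (hg : ContDiff ℝ 2 g)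
    {g₁ : ℂ × ℂ → ℂ × ℂ → ℂ} {g₂ : ℂ × ℂ → ℂ × ℂ → ℂ} {p : ℂ × ℂ}
    (h₁ : ∀ v q, HasDerivAt (fun s : ℝ => g (q + s • v)) (g₁ v q) 0)
    (h₂ : ∀ u v, HasDerivAt (fun s : ℝ => g₁ v (p + s • u)) (g₂ u v) 0)
    (hI₁ : ∀ u, g₁ (I • u) p = I * g₁ u p) (hI₂ : ∀ u v, g₂ (I • u) v = g₂ u (I • v))
    (u v : ℂ × ℂ) :
    ddbarModel (fun q => normSq (g q)) p u v =
      (1 / Real.pi) * ((starRingEnd ℂ) (g₁ u p) * g₁ v p).im := by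
  have key : ∀ u v, fderiv ℝ (fderiv ℝ fun q => normSq (g q)) p u v =
      2 * ((starRingEnd ℂ) (g₁ u p) * g₁ v p + (starRingEnd ℂ) (g p) * g₂ u v).re := by
    intro u v
    refine fderiv_fderiv_apply_eq (contDiff_normSq.comp hg).contDiffAt
      (G := fun q => 2 * ((starRingEnd ℂ) (g q) * g₁ v q).re)
      (Filter.Eventually.of_forall fun q => ?_) ?_
    · simpa using hasDerivAt_normSq (h₁ v q)
    · have h3 := ((h₁ u p).star.mul (h₂ u v))
      have h4 := (Complex.reCLM.hasFDerivAt.comp_hasDerivAt (0 : ℝ) h3).const_mul (2 : ℝ)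
      simpa using h4
  unfold ddbarModel
  rw [key, key, hI₁, hI₁, hI₂]
  simp only [add_re, mul_re, mul_im, conj_re, conj_im, I_re, I_im]
  field_simp
  ring

open Complex in
lemma ddbarModel_normSq_clm (ℓ : ℂ × ℂ →L[ℂ] ℂ) (p u v : ℂ × ℂ) :
    ddbarModel (fun q => normSq (ℓ q)) p u v =
      (1 / Real.pi) * ((starRingEnd ℂ) (ℓ u) * ℓ v).im := by
  have hs : ∀ (s : ℝ) (u : ℂ × ℂ), ℓ (s • u) = s * ℓ u := fun s u => by
    rw [← Complex.coe_smul, map_smul, smul_eq_mul]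
  refine ddbarModel_normSq_comp (g := ℓ) (g₁ := fun v _ => ℓ v) (g₂ := fun _ _ => 0)
    (ℓ.restrictScalars ℝ).contDiff ?_ ?_ ?_ ?_ u v
  · intro v q
    simp only [map_add, hs]
    have := ((hasDerivAt_id (0 : ℝ)).ofReal_comp.mul_const (ℓ v)).const_add (ℓ q)
    simpa using this
  · intro u v
    exact hasDerivAt_const _ _
  · intro u
    simp
  · intro u v
    rfl

open Complex in
lemma ddbarModel_normSq_mul (p u v : ℂ × ℂ) :
    ddbarModel (fun q => normSq (q.1 * q.2)) p u v =
      (1 / Real.pi) *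
        ((starRingEnd ℂ) (p.1 * u.2 + p.2 * u.1) * (p.1 * v.2 + p.2 * v.1)).im := by
  have hl : ∀ a b : ℂ, HasDerivAt (fun s : ℝ => a + s * b) b 0 := fun a b => by
    simpa using ((hasDerivAt_id (0 : ℝ)).ofReal_comp.mul_const b).const_add a
  refine ddbarModel_normSq_comp (g := fun q => q.1 * q.2)
    (g₁ := fun v q => q.1 * v.2 + q.2 * v.1)
    (g₂ := fun u v => u.1 * v.2 + u.2 * v.1) (contDiff_fst.mul contDiff_snd) ?_ ?_ ?_ ?_ u v
  · intro v q
    exact (((hl q.1 v.1).fun_mul (hl q.2 v.2)).congr_deriv (by simp; ring)).congr_of_eventuallyEq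
      (.of_forall fun s => by simp)
  · intro u v
    exact (((hl p.1 u.1).mul_const v.2).fun_add ((hl p.2 u.2).mul_const v.1)).congr_deriv
      (by ring) |>.congr_of_eventuallyEq (.of_forall fun s => by simp)
  · intro u
    simp; ring
  · intro u v
    simp; ring

open Complex in
lemma ddbarModel_log_const_add_normSq (c : ℝ) (ℓ : ℂ × ℂ →L[ℂ] ℂ) {p : ℂ × ℂ}
    (hp : c + normSq (ℓ p) ≠ 0) (u v : ℂ × ℂ) :
    ddbarModel (fun q => Real.log (c + normSq (ℓ q))) p u v =
      (1 / Real.pi) * (c * ((starRingEnd ℂ) (ℓ u) * ℓ v).im / (c + normSq (ℓ p)) ^ 2) := by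
  have hs : ∀ (s : ℝ) (u : ℂ × ℂ), ℓ (s • u) = s * ℓ u := fun s u => by
    rw [← Complex.coe_smul, map_smul, smul_eq_mul]
  have hl : ∀ u q : ℂ × ℂ, HasDerivAt (fun s : ℝ => ℓ (q + s • u)) (ℓ u) 0 := fun u q => by
    simp only [map_add, hs]
    simpa using ((hasDerivAt_id (0 : ℝ)).ofReal_comp.mul_const (ℓ u)).const_add (ℓ q)
  have hN : ContDiff ℝ 2 fun q => c + normSq (ℓ q) :=
    contDiff_const.add (contDiff_normSq.comp (ℓ.restrictScalars ℝ).contDiff)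
  have hB : ∀ u q, HasDerivAt (fun s : ℝ => c + normSq (ℓ (q + s • u)))
      (2 * ((starRingEnd ℂ) (ℓ q) * ℓ u).re) 0 := fun u q => by
    simpa using (hasDerivAt_normSq (hl u q)).const_add c
  have key : ∀ u v, fderiv ℝ (fderiv ℝ fun q => Real.log (c + normSq (ℓ q))) p u v =
      (2 * ((starRingEnd ℂ) (ℓ u) * ℓ v).re * (c + normSq (ℓ p)) -
        2 * ((starRingEnd ℂ) (ℓ p) * ℓ v).re * (2 * ((starRingEnd ℂ) (ℓ p) * ℓ u).re)) /
        (c + normSq (ℓ p)) ^ 2 := by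
    intro u v
    refine fderiv_fderiv_apply_eq (hN.contDiffAt.log hp)
      (G := fun q => 2 * ((starRingEnd ℂ) (ℓ q) * ℓ v).re / (c + normSq (ℓ q))) ?_ ?_
    · filter_upwards [hN.continuous.continuousAt.eventually_ne hp] with q hq
      simpa using (hB v q).log (by simpa using hq)
    · have h4 := (Complex.reCLM.hasFDerivAt.comp_hasDerivAt (0 : ℝ)
        ((hl u p).star.mul_const (ℓ v))).const_mul (2 : ℝ)
      have h5 := h4.fun_div (hB u p) (by simpa using hp)
      simpa using h5
  unfold ddbarModel
  rw [key, key]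
  simp only [map_smul, smul_eq_mul, mul_re, mul_im, conj_re, conj_im, I_re, I_im]
  have e : normSq (ℓ p) = (ℓ p).re * (ℓ p).re + (ℓ p).im * (ℓ p).im := normSq_apply _
  have hpi := Real.pi_ne_zero
  rw [e] at hp ⊢
  field_simp
  ring

/-- The local potential `|w₁ w₂|² + |ℓ w|² + log (1 + |ℓ' w|²)`.  With `ℓ`, `ℓ'` the two
coordinates, in this order or interchanged, it is the potential of the Simanca form in the first or in the
second chart. -/
def potential (ℓ ℓ' : ℂ × ℂ →L[ℂ] ℂ) (w : ℂ × ℂ) : ℝ :=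
  Complex.normSq (w.1 * w.2) + Complex.normSq (ℓ w) + Real.log (1 + Complex.normSq (ℓ' w))

lemma one_add_normSq_pos (z : ℂ) : 0 < 1 + Complex.normSq z := by
  have := Complex.normSq_nonneg z
  linarith

lemma contDiff_normSq_clm {n : ℕ∞ω} (ℓ : ℂ × ℂ →L[ℂ] ℂ) :
    ContDiff ℝ n fun w => Complex.normSq (ℓ w) :=
  contDiff_normSq.comp (ℓ.restrictScalars ℝ).contDiff

lemma contDiff_normSq_mul {n : ℕ∞ω} :
    ContDiff ℝ n fun w : ℂ × ℂ => Complex.normSq (w.1 * w.2) :=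
  contDiff_normSq.comp (contDiff_fst.mul contDiff_snd)

lemma contDiff_log_one_add_normSq_clm {n : ℕ∞ω} (ℓ : ℂ × ℂ →L[ℂ] ℂ) :
    ContDiff ℝ n fun w => Real.log (1 + Complex.normSq (ℓ w)) :=
  (contDiff_const.add (contDiff_normSq_clm ℓ)).log fun w => (one_add_normSq_pos (ℓ w)).ne'

lemma contDiff_potential {n : ℕ∞ω} (ℓ ℓ' : ℂ × ℂ →L[ℂ] ℂ) : ContDiff ℝ n (potential ℓ ℓ') :=
  (contDiff_normSq_mul.add (contDiff_normSq_clm ℓ)).add (contDiff_log_one_add_normSq_clm ℓ')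

lemma ddbarModel_potential (ℓ ℓ' : ℂ × ℂ →L[ℂ] ℂ) (p u v : ℂ × ℂ) :
    ddbarModel (potential ℓ ℓ') p u v = (1 / Real.pi) *
      (((starRingEnd ℂ) (p.1 * u.2 + p.2 * u.1) * (p.1 * v.2 + p.2 * v.1)).im +
        ((starRingEnd ℂ) (ℓ u) * ℓ v).im +
        ((starRingEnd ℂ) (ℓ' u) * ℓ' v).im / (1 + Complex.normSq (ℓ' p)) ^ 2) := by
  unfold potential
  rw [ddbarModel_add (contDiff_normSq_mul.add (contDiff_normSq_clm ℓ)).contDiffAt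
      (contDiff_log_one_add_normSq_clm ℓ').contDiffAt,
    ddbarModel_add contDiff_normSq_mul.contDiffAt (contDiff_normSq_clm ℓ).contDiffAt,
    ddbarModel_normSq_mul, ddbarModel_normSq_clm,
    ddbarModel_log_const_add_normSq 1 ℓ' (one_add_normSq_pos _).ne']
  ring

/-- Multiples of `log |ℓ''|²` are pluriharmonic where `ℓ'' ≠ 0`, so that they may be added to the
potential. -/
lemma ddbarModel_potential_add_log (ℓ ℓ' ℓ'' : ℂ × ℂ →L[ℂ] ℂ) (c : ℝ) {F : ℂ × ℂ → ℝ}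
    {p : ℂ × ℂ} (hp : ℓ'' p ≠ 0)
    (hF : ∀ w, ℓ'' w ≠ 0 → F w = potential ℓ ℓ' w + c * Real.log (Complex.normSq (ℓ'' w)))
    (u v : ℂ × ℂ) :
    ddbarModel F p u v = ddbarModel (potential ℓ ℓ') p u v := by
  have h1 : F =ᶠ[𝓝 p] fun w => potential ℓ ℓ' w + c * Real.log (0 + Complex.normSq (ℓ'' w)) := by
    filter_upwards [ℓ''.continuous.continuousAt.eventually_ne hp] with w hw
    rw [hF w hw, zero_add]
  have hp' : 0 + Complex.normSq (ℓ'' p) ≠ 0 := by simpa using hp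
  rw [ddbarModel_congr h1, ddbarModel_add (contDiff_potential ℓ ℓ').contDiffAt
    (contDiffAt_const.mul (((contDiff_const.add (contDiff_normSq_clm ℓ'')).contDiffAt).log hp')),
    ddbarModel_const_mul, ddbarModel_log_const_add_normSq 0 ℓ'' hp']
  simp

/-! ### The Simanca form in the two charts -/

namespace BlowUp

lemma chartAt_of_ne {x : BlowUp} (hx : x.t.1 ≠ 0) : chartAt (ℂ × ℂ) x = chart₁ := if_pos hx

lemma chartAt_of_eq {x : BlowUp} (hx : x.t.1 = 0) : chartAt (ℂ × ℂ) x = chart₂ :=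
  if_neg (not_not.mpr hx)

lemma t_snd_ne_zero {x : BlowUp} (hx : x.t.1 = 0) : x.t.2 ≠ 0 :=
  fun h => x.t_ne_zero (Prod.ext hx h)

lemma t_param₁_fst_ne_zero (w : ℂ × ℂ) : (param₁ w).t.1 ≠ 0 := by
  obtain ⟨a, ha, h⟩ := t_param₁ w
  simpa [h]

lemma t_param₂_snd_ne_zero (w : ℂ × ℂ) : (param₂ w).t.2 ≠ 0 := by
  obtain ⟨a, ha, h⟩ := t_param₂ w
  simpa [h]

lemma t_param₁_div (w : ℂ × ℂ) : (param₁ w).t.2 / (param₁ w).t.1 = w.2 := by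
  obtain ⟨a, ha, h⟩ := t_param₁ w
  simp [h, ha]

lemma t_param₁_div' (w : ℂ × ℂ) : (param₁ w).t.1 / (param₁ w).t.2 = w.2⁻¹ := by
  rw [← inv_div, t_param₁_div]

lemma t_param₂_div (w : ℂ × ℂ) : (param₂ w).t.1 / (param₂ w).t.2 = w.1 := by
  obtain ⟨a, ha, h⟩ := t_param₂ w
  simp [h, ha]

lemma t_param₂_fst_eq_zero_iff (w : ℂ × ℂ) : (param₂ w).t.1 = 0 ↔ w.1 = 0 := by
  obtain ⟨a, ha, h⟩ := t_param₂ w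
  simp [h, ha]

lemma t_param₁_snd_eq_zero_iff (w : ℂ × ℂ) : (param₁ w).t.2 = 0 ↔ w.2 = 0 := by
  obtain ⟨a, ha, h⟩ := t_param₁ w
  simp [h, ha]

lemma param₁_chart₁ {x : BlowUp} (hx : x.t.1 ≠ 0) : param₁ (x.z.1, x.t.2 / x.t.1) = x :=
  chart₁.left_inv hx

lemma param₂_chart₂ {x : BlowUp} (hx : x.t.2 ≠ 0) : param₂ (x.t.1 / x.t.2, x.z.2) = x :=
  chart₂.left_inv hx

lemma normSqZ_param₁ (w : ℂ × ℂ) :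
    normSqZ (param₁ w) = Complex.normSq w.1 + Complex.normSq (w.1 * w.2) := rfl

lemma normSqZ_param₂ (w : ℂ × ℂ) :
    normSqZ (param₂ w) = Complex.normSq (w.1 * w.2) + Complex.normSq w.2 := rfl

end BlowUp

open BlowUp

lemma ddbar_of_ne (f : BlowUp → ℝ) {x : BlowUp} (hx : x.t.1 ≠ 0) (u v : ℂ × ℂ) :
    ddbar f x u v = ddbarModel (f ∘ param₁) (x.z.1, x.t.2 / x.t.1) u v := by
  unfold ddbar
  rw [chartAt_of_ne hx]
  rfl

lemma ddbar_of_eq (f : BlowUp → ℝ) {x : BlowUp} (hx : x.t.1 = 0) (u v : ℂ × ℂ) :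
    ddbar f x u v = ddbarModel (f ∘ param₂) (x.t.1 / x.t.2, x.z.2) u v := by
  unfold ddbar
  rw [chartAt_of_eq hx]
  rfl

/-- The first linear coordinate of the model space. -/
abbrev fstL : ℂ × ℂ →L[ℂ] ℂ := ContinuousLinearMap.fst ℂ ℂ ℂ

/-- The second linear coordinate of the model space. -/
abbrev sndL : ℂ × ℂ →L[ℂ] ℂ := ContinuousLinearMap.snd ℂ ℂ ℂ

/-- The potential of the Simanca form on the open set `t₁ ≠ 0`. -/
def kahlerPotential₁ (y : BlowUp) : ℝ := normSqZ y + Real.log (1 + Complex.normSq (y.t.2 / y.t.1))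

/-- The potential of the Simanca form on the open set `t₂ ≠ 0`. -/
def kahlerPotential₂ (y : BlowUp) : ℝ := normSqZ y + Real.log (1 + Complex.normSq (y.t.1 / y.t.2))

lemma kahlerPotential₁_comp_param₁ : kahlerPotential₁ ∘ param₁ = potential fstL sndL := by
  ext w
  simp only [Function.comp_apply, kahlerPotential₁, potential, normSqZ_param₁, t_param₁_div,
    ContinuousLinearMap.coe_fst', ContinuousLinearMap.coe_snd']
  ring

lemma kahlerPotential₂_comp_param₂ : kahlerPotential₂ ∘ param₂ = potential sndL fstL := by
  ext w
  simp only [Function.comp_apply, kahlerPotential₂, potential, normSqZ_param₂, t_param₂_div,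
    ContinuousLinearMap.coe_fst', ContinuousLinearMap.coe_snd']

lemma simancaForm_of_ne {x : BlowUp} (hx : x.t.1 ≠ 0) (u v : ℂ × ℂ) :
    simancaForm x u v = ddbarModel (potential fstL sndL) (x.z.1, x.t.2 / x.t.1) u v := by
  unfold simancaForm
  rw [if_pos hx, ddbar_of_ne _ hx, ← kahlerPotential₁_comp_param₁]
  rfl

lemma simancaForm_of_eq {x : BlowUp} (hx : x.t.1 = 0) (u v : ℂ × ℂ) :
    simancaForm x u v = ddbarModel (potential sndL fstL) (x.t.1 / x.t.2, x.z.2) u v := by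
  unfold simancaForm
  rw [if_neg (not_not.mpr hx), ddbar_of_eq _ hx, ← kahlerPotential₂_comp_param₂]
  rfl

lemma simancaForm_eq_ddbar₁ {x : BlowUp} (hx : x.t.1 ≠ 0) :
    simancaForm x = ddbar kahlerPotential₁ x := by
  unfold simancaForm
  rw [if_pos hx]
  rfl

lemma simancaForm_eq_ddbar₂ {x : BlowUp} (hx : x.t.2 ≠ 0) :
    simancaForm x = ddbar kahlerPotential₂ x := by
  by_cases h : x.t.1 = 0
  · unfold simancaForm
    rw [if_neg (not_not.mpr h)]
    rfl
  · funext u v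
    have hp : sndL (x.z.1, x.t.2 / x.t.1) ≠ 0 := div_ne_zero hx h
    refine (simancaForm_of_ne h u v).trans ((ddbar_of_ne kahlerPotential₂ h u v).trans
      (ddbarModel_potential_add_log fstL sndL sndL (-1) hp (fun w hw => ?_) u v)).symm
    have hw' : Complex.normSq w.2 ≠ 0 := by simpa using hw
    have hlog : Real.log (1 + Complex.normSq w.2⁻¹) =
        Real.log (1 + Complex.normSq w.2) - Real.log (Complex.normSq w.2) := by
      rw [← Real.log_div (one_add_normSq_pos _).ne' hw', Complex.normSq_inv]
      congr 1
      field_simp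
      ring
    simp only [Function.comp_apply, kahlerPotential₂, potential, normSqZ_param₁, t_param₁_div',
      ContinuousLinearMap.coe_fst', ContinuousLinearMap.coe_snd', hlog]
    ring

lemma simancaForm_eq_ddbar_log {x : BlowUp} (hx : x.z ≠ 0) :
    simancaForm x = ddbar (fun y => normSqZ y + Real.log (normSqZ y)) x := by
  funext u v
  by_cases h : x.t.1 = 0
  · have h2 := t_snd_ne_zero h
    have hp : sndL (x.t.1 / x.t.2, x.z.2) ≠ 0 := by
      intro h0
      refine hx ?_
      have h0' : x.z.2 = 0 := h0
      have h3 := x.incidence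
      rw [h0', mul_zero, eq_comm] at h3
      exact Prod.ext ((mul_eq_zero.mp h3).resolve_left h2) h0'
    refine (simancaForm_of_eq h u v).trans ((ddbar_of_eq _ h u v).trans
      (ddbarModel_potential_add_log sndL fstL sndL 1 hp (fun w hw => ?_) u v)).symm
    have hw' : Complex.normSq w.2 ≠ 0 := by simpa using hw
    have : Complex.normSq (w.1 * w.2) + Complex.normSq w.2 =
        (1 + Complex.normSq w.1) * Complex.normSq w.2 := by
      rw [Complex.normSq_mul]; ring
    simp only [Function.comp_apply, potential, normSqZ_param₂,
      ContinuousLinearMap.coe_fst', ContinuousLinearMap.coe_snd']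
    rw [this, Real.log_mul (one_add_normSq_pos _).ne' hw', ← this]
    ring
  · -- if `z₁ = 0` and `t₁ ≠ 0`, then `z₂ = 0` by the incidence relation
    have hp : fstL (x.z.1, x.t.2 / x.t.1) ≠ 0 := by
      intro h0
      refine hx ?_
      have h0' : x.z.1 = 0 := h0
      have h3 := x.incidence
      rw [h0', mul_zero] at h3
      exact Prod.ext h0' ((mul_eq_zero.mp h3).resolve_left h)
    refine (simancaForm_of_ne h u v).trans ((ddbar_of_ne _ h u v).trans
      (ddbarModel_potential_add_log fstL sndL fstL 1 hp (fun w hw => ?_) u v)).symm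
    have hw' : Complex.normSq w.1 ≠ 0 := by simpa using hw
    have : Complex.normSq w.1 + Complex.normSq (w.1 * w.2) =
        (1 + Complex.normSq w.2) * Complex.normSq w.1 := by
      rw [Complex.normSq_mul]; ring
    simp only [Function.comp_apply, potential, normSqZ_param₁,
      ContinuousLinearMap.coe_fst', ContinuousLinearMap.coe_snd']
    rw [this, Real.log_mul (one_add_normSq_pos _).ne' hw', ← this]
    ring

/-- The underlying smooth manifold. -/
instance : IsManifold 𝓘(ℝ, ℂ × ℂ) ∞ BlowUp := by
  refine isManifold_of_contDiffOn _ _ _ fun e e' he he' => ?_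
  have h := (contDiffGroupoid ω 𝓘(ℂ, ℂ × ℂ)).compatible he he'
  rw [contDiffGroupoid, mem_groupoid_of_pregroupoid] at h
  have h1 : ContDiffOn ℂ ω (𝓘(ℂ, ℂ × ℂ) ∘ (e.symm ≫ₕ e') ∘ 𝓘(ℂ, ℂ × ℂ).symm)
    (𝓘(ℂ, ℂ × ℂ).symm ⁻¹' (e.symm ≫ₕ e').source ∩ Set.range 𝓘(ℂ, ℂ × ℂ)) := h.1
  exact (h1.restrict_scalars ℝ).of_le le_top

lemma contMDiffOn_of_comp_chart {e : OpenPartialHomeomorph BlowUp (ℂ × ℂ)}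
    (he : e ∈ atlas (ℂ × ℂ) BlowUp) {F : ℂ × ℂ → ℝ} (hF : ContDiff ℝ ∞ F) {f : BlowUp → ℝ}
    (h : ∀ x ∈ e.source, f x = F (e x)) : ContMDiffOn 𝓘(ℝ, ℂ × ℂ) 𝓘(ℝ, ℝ) ∞ f e.source :=
  (hF.contMDiff.comp_contMDiffOn
    (contMDiffOn_of_mem_maximalAtlas (IsManifold.subset_maximalAtlas he))).congr h

lemma chart₁_mem_atlas : chart₁ ∈ atlas (ℂ × ℂ) BlowUp := Set.mem_insert _ _

lemma chart₂_mem_atlas : chart₂ ∈ atlas (ℂ × ℂ) BlowUp := Set.mem_insert_of_mem _ rfl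

lemma ddbarModel_potential_I_pos (ℓ ℓ' : ℂ × ℂ →L[ℂ] ℂ) (p : ℂ × ℂ) {u : ℂ × ℂ}
    (hu : ℓ u ≠ 0 ∨ ℓ' u ≠ 0) : 0 < ddbarModel (potential ℓ ℓ') p u (Complex.I • u) := by
  have key : ∀ a : ℂ, ((starRingEnd ℂ) a * (Complex.I * a)).im = Complex.normSq a := by
    intro a
    simp [Complex.normSq_apply]
  rw [ddbarModel_potential]
  simp only [Prod.smul_fst, Prod.smul_snd, map_smul, smul_eq_mul, key]
  have h1 : p.1 * (Complex.I * u.2) + p.2 * (Complex.I * u.1) =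
      Complex.I * (p.1 * u.2 + p.2 * u.1) := by ring
  rw [h1, key]
  refine mul_pos (by positivity) ?_
  have h2 := Complex.normSq_nonneg (p.1 * u.2 + p.2 * u.1)
  have h3 := Complex.normSq_nonneg (ℓ u)
  have h5 := one_add_normSq_pos (ℓ' p)
  have h4 : 0 ≤ Complex.normSq (ℓ' u) / (1 + Complex.normSq (ℓ' p)) ^ 2 :=
    div_nonneg (Complex.normSq_nonneg _) (by positivity)
  rcases hu with hu | hu
  · have := Complex.normSq_pos.mpr hu
    linarith
  · have : 0 < Complex.normSq (ℓ' u) / (1 + Complex.normSq (ℓ' p)) ^ 2 :=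
      div_pos (Complex.normSq_pos.mpr hu) (by positivity)
    linarith

theorem isKahlerForm_simancaForm : IsKahlerForm simancaForm := by
  refine ⟨fun x => ?_, fun x u hu => ?_⟩
  · by_cases hx : x.t.1 = 0
    · refine ⟨chart₂.source, chart₂.open_source, t_snd_ne_zero hx, kahlerPotential₂,
        contMDiffOn_of_comp_chart chart₂_mem_atlas (contDiff_potential sndL fstL) fun y hy => ?_,
        fun y hy => simancaForm_eq_ddbar₂ hy⟩
      rw [← kahlerPotential₂_comp_param₂]
      exact congrArg kahlerPotential₂ (chart₂.left_inv hy).symm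
    · refine ⟨chart₁.source, chart₁.open_source, hx, kahlerPotential₁,
        contMDiffOn_of_comp_chart chart₁_mem_atlas (contDiff_potential fstL sndL) fun y hy => ?_,
        fun y hy => simancaForm_eq_ddbar₁ hy⟩
      rw [← kahlerPotential₁_comp_param₁]
      exact congrArg kahlerPotential₁ (chart₁.left_inv hy).symm
  · have hu' : ∀ {w : ℂ × ℂ}, w ≠ 0 → w.1 ≠ 0 ∨ w.2 ≠ 0 := fun {w} hw => by
      by_contra! h
      exact hw (Prod.ext h.1 h.2)
    by_cases hx : x.t.1 = 0
    · exact (ddbarModel_potential_I_pos sndL fstL _ (hu' hu).symm).trans_eq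
        (simancaForm_of_eq hx _ _).symm
    · exact (ddbarModel_potential_I_pos fstL sndL _ (hu' hu)).trans_eq
        (simancaForm_of_ne hx _ _).symm

lemma volumeDensity_simancaForm_param₁ (w : ℂ × ℂ) :
    volumeDensity simancaForm (param₁ w) =
      (1 / Real.pi ^ 2) * (Complex.normSq w.1 + 1 / (1 + Complex.normSq w.2)) := by
  have hw := t_param₁_fst_ne_zero w
  have key : ∀ u v : ℂ × ℂ, simancaForm (param₁ w) u v = (1 / Real.pi) *
      (((starRingEnd ℂ) (w.1 * u.2 + w.2 * u.1) * (w.1 * v.2 + w.2 * v.1)).im +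
        ((starRingEnd ℂ) u.1 * v.1).im +
        ((starRingEnd ℂ) u.2 * v.2).im / (1 + Complex.normSq w.2) ^ 2) := by
    intro u v
    rw [simancaForm_of_ne hw, t_param₁_div, ddbarModel_potential]
    rfl
  have hB := (one_add_normSq_pos w.2).ne'
  have hpi := Real.pi_ne_zero
  unfold volumeDensity
  simp only [key]
  simp only [Complex.normSq_apply, Complex.mul_re, Complex.mul_im, Complex.add_re, Complex.add_im,
    Complex.conj_re, Complex.conj_im, Complex.I_re, Complex.I_im, Complex.one_re, Complex.one_im,
    Complex.zero_re, Complex.zero_im] at hB ⊢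
  field_simp
  ring

open BlowUp HolomorphicLineBundle

/-! ### Line bundles and Hermitian metrics -/

section General

variable {M : Type*} [TopologicalSpace M] [ChartedSpace (ℂ × ℂ) M]

namespace HolomorphicLineBundle

variable (L : HolomorphicLineBundle M)

/-- The coordinate of an element of a fibre in the preferred trivialization.  The fibres are copies
of `ℂ`, and this is the identity. -/
def val {L : HolomorphicLineBundle M} {x : M} (v : L.Fiber x) : ℂ := v

lemma frame_of_mem {i : L.ι} {x : M} (hx : x ∈ L.core.baseSet i) :
    val (L.frame i x) = L.core.coordChange i (L.core.indexAt x) x 1 :=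
  L.core.localTriv_symm_apply (i := i) hx 1

lemma frame_pow (m : ℕ) {i : L.ι} {x : M} (hx : x ∈ L.core.baseSet i) :
    val ((L.pow m).frame i x) = val (L.frame i x) ^ m := by
  rw [L.frame_of_mem hx, (L.pow m).frame_of_mem (i := i) hx]
  simp [pow]

end HolomorphicLineBundle

namespace HermitianMetric

/-- The form `(v, w) ↦ ρ v̄ w` on `ℂ`. -/
def scaledForm (ρ : ℝ) : ℂ →ₗ⋆[ℂ] ℂ →ₗ[ℂ] ℂ :=
  LinearMap.mk₂'ₛₗ (starRingEnd ℂ) (RingHom.id ℂ) (fun v w => (ρ : ℂ) * ((starRingEnd ℂ) v * w))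
    (fun v v' w => by simp; ring) (fun c v w => by simp; ring) (fun v w w' => by ring)
    (fun c v w => by simp; ring)

lemma scaledForm_apply (ρ : ℝ) (v w : ℂ) :
    scaledForm ρ v w = (ρ : ℂ) * ((starRingEnd ℂ) v * w) := rfl

lemma scaledForm_self_re (ρ : ℝ) (v : ℂ) : (scaledForm ρ v v).re = Complex.normSq v * ρ := by
  rw [scaledForm_apply, mul_comm ((starRingEnd ℂ) v), Complex.mul_conj, ← Complex.ofReal_mul,
    Complex.ofReal_re, mul_comm]

lemma scaledForm_conj_symm (ρ : ℝ) (v w : ℂ) :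
    (starRingEnd ℂ) (scaledForm ρ v w) = scaledForm ρ w v := by
  rw [scaledForm_apply, scaledForm_apply]
  simp [mul_comm]

lemma scaledForm_self_re_pos {ρ : ℝ} (hρ : 0 < ρ) {v : ℂ} (hv : v ≠ 0) :
    0 < (scaledForm ρ v v).re := by
  rw [scaledForm_self_re]
  exact mul_pos (Complex.normSq_pos.mpr hv) hρ

/-- The Hermitian metric with given squared lengths `ρ x > 0` of the unit vector of the preferred
trivialization. -/
def ofWeight (L : HolomorphicLineBundle M) (ρ : M → ℝ) (hρ : ∀ x, 0 < ρ x)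
    (hs : ∀ i : L.ι, ContMDiffOn 𝓘(ℝ, ℂ × ℂ) 𝓘(ℝ, ℝ) ∞
      (fun x => Complex.normSq (val (L.frame i x)) * ρ x) (L.core.baseSet i)) :
    HermitianMetric L where
  form x := scaledForm (ρ x)
  conj_symm x := scaledForm_conj_symm (ρ x)
  pos x _ hv := scaledForm_self_re_pos (hρ x) hv
  smooth i := (hs i).congr fun x _ => scaledForm_self_re (ρ x) (val (L.frame i x))

variable {L : HolomorphicLineBundle M}

lemma ofWeight_sq (ρ : M → ℝ) (hρ : ∀ x, 0 < ρ x) (hs) {x : M} (v : L.Fiber x) :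
    (ofWeight L ρ hρ hs).sq v = Complex.normSq (val v) * ρ x :=
  scaledForm_self_re (ρ x) (val v)

end HermitianMetric

end General

/-! ### The hyperplane bundle and the quantization -/

namespace BlowUp

/-- The homogeneous coordinates of `[t]`: `t₁` for the index `true`, `t₂` for `false`. -/
def tc (i : Bool) (x : BlowUp) : ℂ := if i then x.t.1 else x.t.2

lemma contMDiffOn_tc_div (i j : Bool) : ContMDiffOn 𝓘(ℂ, ℂ × ℂ) 𝓘(ℂ, ℂ) ω
    (fun x => tc i x / tc j x) {x | tc j x ≠ 0} := by
  have h1 := contMDiffOn_of_mem_maximalAtlas (I := 𝓘(ℂ, ℂ × ℂ)) (n := ω)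
    (IsManifold.subset_maximalAtlas chart₁_mem_atlas)
  have h2 := contMDiffOn_of_mem_maximalAtlas (I := 𝓘(ℂ, ℂ × ℂ)) (n := ω)
    (IsManifold.subset_maximalAtlas chart₂_mem_atlas)
  have hdiag : ∀ k, ContMDiffOn 𝓘(ℂ, ℂ × ℂ) 𝓘(ℂ, ℂ) ω (fun x => tc k x / tc k x)
      {x | tc k x ≠ 0} := fun k =>
    (contMDiffOn_const (c := (1 : ℂ))).congr fun x hx => div_self hx
  cases i <;> cases j
  · exact hdiag false
  · exact (contDiff_snd (𝕜 := ℂ)).contMDiff.comp_contMDiffOn h1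
  · exact (contDiff_fst (𝕜 := ℂ)).contMDiff.comp_contMDiffOn h2
  · exact hdiag true

lemma isOpen_tc_ne (i : Bool) : IsOpen {x | tc i x ≠ 0} := by
  cases i
  · exact chart₂.open_source
  · exact chart₁.open_source

open scoped Classical in
/-- The index of the preferred chart: `true` for `chart₁`, `false` for `chart₂`. -/
def index (x : BlowUp) : Bool := if x.t.1 ≠ 0 then true else false

lemma index_of_ne {x : BlowUp} (hx : x.t.1 ≠ 0) : index x = true := if_pos hx

lemma index_of_eq {x : BlowUp} (hx : x.t.1 = 0) : index x = false := if_neg (not_not.mpr hx)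

lemma tc_index_ne_zero (x : BlowUp) : tc (index x) x ≠ 0 := by
  by_cases hx : x.t.1 = 0
  · rw [index_of_eq hx]
    exact t_snd_ne_zero hx
  · rw [index_of_ne hx]
    exact hx

end BlowUp

/-- The pull-back `𝒪(1)` of the hyperplane bundle of `ℂP¹` to the blow-up, with the frames `t₁`,
`t₂`. -/
def hyperplaneBundle : HolomorphicLineBundle BlowUp where
  ι := Bool
  core :=
    { baseSet := fun i => {x | tc i x ≠ 0}
      isOpen_baseSet := isOpen_tc_ne
      indexAt := index
      mem_baseSet_at := tc_index_ne_zero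
      coordChange := fun i j x => (tc i x / tc j x) • ContinuousLinearMap.id ℂ ℂ
      coordChange_self := fun i x hx v => by
        have hx' : tc i x ≠ 0 := hx
        simp [hx']
      continuousOn_coordChange := fun i j =>
        ((contMDiffOn_tc_div i j).continuousOn.mono Set.inter_subset_right).smul continuousOn_const
      coordChange_comp := fun i j k x hx v => by
        obtain ⟨⟨hi, hj⟩, hk⟩ := hx
        have hj' : tc j x ≠ 0 := hj
        have hk' : tc k x ≠ 0 := hk
        simp only [smul_apply, ContinuousLinearMap.id_apply, smul_eq_mul]
        field_simp }
  holomorphic := ⟨fun i j =>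
    ((contMDiffOn_tc_div i j).mono Set.inter_subset_right).smul contMDiffOn_const⟩

/-- The potential of the Simanca form on the set `tᵢ ≠ 0`. -/
def kahlerPotential (i : Bool) (x : BlowUp) : ℝ :=
  if i then kahlerPotential₁ x else kahlerPotential₂ x

/-- The squared length of the unit vector of the preferred trivialization of `𝒪(1)`. -/
def weight (x : BlowUp) : ℝ := Real.exp (-kahlerPotential (index x) x)

lemma weight_pos (x : BlowUp) : 0 < weight x := Real.exp_pos _

lemma contMDiffOn_kahlerPotential (i : Bool) :
    ContMDiffOn 𝓘(ℝ, ℂ × ℂ) 𝓘(ℝ, ℝ) ∞ (kahlerPotential i) {x | tc i x ≠ 0} := by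
  cases i
  · refine contMDiffOn_of_comp_chart chart₂_mem_atlas (contDiff_potential sndL fstL) fun y hy => ?_
    rw [← kahlerPotential₂_comp_param₂]
    exact congrArg kahlerPotential₂ (chart₂.left_inv hy).symm
  · refine contMDiffOn_of_comp_chart chart₁_mem_atlas (contDiff_potential fstL sndL) fun y hy => ?_
    rw [← kahlerPotential₁_comp_param₁]
    exact congrArg kahlerPotential₁ (chart₁.left_inv hy).symm

/-- The right-hand side is `e^{-|z|²} |tᵢ|² / |t|²`, so these local weights transform as the squared
lengths of the frames `tᵢ` do. -/
lemma exp_neg_kahlerPotential {i : Bool} {x : BlowUp} (hx : tc i x ≠ 0) :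
    Real.exp (-kahlerPotential i x) = Real.exp (-normSqZ x) * (Complex.normSq (tc i x) /
      (Complex.normSq x.t.1 + Complex.normSq x.t.2)) := by
  have h0 := x.t_ne_zero
  have h1 := Complex.normSq_nonneg x.t.1
  have h2 := Complex.normSq_nonneg x.t.2
  cases i
  · have h : Complex.normSq x.t.2 ≠ 0 := by simpa [tc] using hx
    have h' : Complex.normSq x.t.1 + Complex.normSq x.t.2 ≠ 0 := by positivity
    have e : kahlerPotential false x =
      normSqZ x + Real.log (1 + Complex.normSq (x.t.1 / x.t.2)) := rfl
    rw [e, neg_add, Real.exp_add, Real.exp_neg (Real.log _), Real.exp_log (one_add_normSq_pos _),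
      Complex.normSq_div]
    simp only [tc, Bool.false_eq_true, if_false]
    field_simp
    ring
  · have h : Complex.normSq x.t.1 ≠ 0 := by simpa [tc] using hx
    have h' : Complex.normSq x.t.1 + Complex.normSq x.t.2 ≠ 0 := by positivity
    have e : kahlerPotential true x =
      normSqZ x + Real.log (1 + Complex.normSq (x.t.2 / x.t.1)) := rfl
    rw [e, neg_add, Real.exp_add, Real.exp_neg (Real.log _), Real.exp_log (one_add_normSq_pos _),
      Complex.normSq_div]
    simp only [tc, if_true]
    field_simp

lemma normSq_frame_mul_weight {i : Bool} {x : BlowUp} (hx : tc i x ≠ 0) :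
    Complex.normSq (val (hyperplaneBundle.frame i x)) * weight x =
      Real.exp (-kahlerPotential i x) := by
  have hj := tc_index_ne_zero x
  have hj' : Complex.normSq (tc (index x) x) ≠ 0 := by simpa using hj
  rw [hyperplaneBundle.frame_of_mem (i := i) hx, weight, exp_neg_kahlerPotential hx,
    exp_neg_kahlerPotential hj]
  have e : hyperplaneBundle.core.coordChange i (hyperplaneBundle.core.indexAt x) x 1 =
    tc i x / tc (index x) x := by simp [hyperplaneBundle]
  rw [e, Complex.normSq_div]
  field_simp

lemma normSq_frame_pow_mul_weight (m : ℕ) {i : Bool} {x : BlowUp} (hx : tc i x ≠ 0) :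
    Complex.normSq (val ((hyperplaneBundle.pow m).frame i x)) * weight x ^ m =
      Real.exp (-kahlerPotential i x) ^ m := by
  rw [hyperplaneBundle.frame_pow m (i := i) hx, map_pow, ← mul_pow, normSq_frame_mul_weight hx]

/-- The Hermitian metric `h_m` on `𝒪(m)`, with `h_m(tᵢᵐ, tᵢᵐ) = (e^{-|z|²} |tᵢ|² / |t|²)ᵐ`. -/
def powMetric (m : ℕ) : HermitianMetric (hyperplaneBundle.pow m) :=
  .ofWeight _ (fun x => weight x ^ m) (fun x => pow_pos (weight_pos x) m) fun i =>
    ((Real.contDiff_exp.contMDiff.comp_contMDiffOn (contMDiffOn_kahlerPotential i).neg).pow m).congr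
      fun _ hx => normSq_frame_pow_mul_weight m hx

/-- The Hermitian metric on `𝒪(1)` with `h(tᵢ, tᵢ) = e^{-|z|²} |tᵢ|² / |t|²`. -/
def hyperplaneMetric : HermitianMetric hyperplaneBundle :=
  .ofWeight _ weight weight_pos fun i =>
    (Real.contDiff_exp.contMDiff.comp_contMDiffOn (contMDiffOn_kahlerPotential i).neg).congr
      fun _ hx => normSq_frame_mul_weight hx

/-- Applied to `f = log h(σ, σ)` for the preferred frame `σ`, where `c` is the tensor power. -/
lemma neg_ddbar_eq_mul_simancaForm {f : BlowUp → ℝ} {c : ℝ} {x : BlowUp}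
    (hf : ∀ y, tc (index x) y ≠ 0 → f y = -(c * kahlerPotential (index x) y)) (u v : ℂ × ℂ) :
    -ddbar f x u v = c * simancaForm x u v := by
  by_cases hx : x.t.1 = 0
  · rw [index_of_eq hx] at hf
    have h : f ∘ param₂ = fun w => (-c) * potential sndL fstL w := by
      ext w
      rw [← kahlerPotential₂_comp_param₂, neg_mul]
      exact hf _ (t_param₂_snd_ne_zero w)
    rw [ddbar_of_eq f hx, h, ddbarModel_const_mul, ← simancaForm_of_eq hx]
    ring
  · rw [index_of_ne hx] at hf
    have h : f ∘ param₁ = fun w => (-c) * potential fstL sndL w := by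
      ext w
      rw [← kahlerPotential₁_comp_param₁, neg_mul]
      exact hf _ (t_param₁_fst_ne_zero w)
    rw [ddbar_of_ne f hx, h, ddbarModel_const_mul, ← simancaForm_of_ne hx]
    ring

lemma powMetric_ricci (m : ℕ) (x : BlowUp) (u v) :
    (powMetric m).ricci x u v = m * simancaForm x u v := by
  refine neg_ddbar_eq_mul_simancaForm (fun y hy => ?_) u v
  have h : (powMetric m).sq ((hyperplaneBundle.pow m).frame (index x) y) =
      Real.exp (-kahlerPotential (index x) y) ^ m :=
    (HermitianMetric.ofWeight_sq _ _ _ _).trans (normSq_frame_pow_mul_weight m hy)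
  refine (congrArg Real.log h).trans ?_
  rw [Real.log_pow, Real.log_exp, mul_neg]

lemma hyperplaneMetric_ricci (x : BlowUp) (u v) :
    hyperplaneMetric.ricci x u v = simancaForm x u v := by
  rw [← one_mul (simancaForm x u v)]
  refine neg_ddbar_eq_mul_simancaForm (fun y hy => ?_) u v
  have h : hyperplaneMetric.sq (hyperplaneBundle.frame (index x) y) =
      Real.exp (-kahlerPotential (index x) y) :=
    (HermitianMetric.ofWeight_sq _ _ _ _).trans (normSq_frame_mul_weight hy)
  refine (congrArg Real.log h).trans ?_
  rw [Real.log_exp, one_mul]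

lemma firstChernClassEq_hyperplaneBundle : FirstChernClassEq hyperplaneBundle simancaForm := by
  have h0 : ∀ x : BlowUp, (0 : OneForm BlowUp).inChart x = 0 := fun x => by
    funext w
    exact ContinuousLinearMap.zero_comp _
  refine ⟨hyperplaneMetric, 0, fun x => ?_, fun x u v => ?_⟩
  · rw [h0]
    exact contDiffOn_const
  · rw [hyperplaneMetric_ricci, sub_self]
    unfold OneForm.d
    rw [h0]
    simp only [fderiv_zero, Pi.zero_apply]
    exact (sub_self (0 : ℝ)).symm

/-- The quantization of the Simanca metric by `𝒪(1)`. -/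
def simancaQuantization : GeometricQuantization simancaForm where
  L := hyperplaneBundle
  chern := firstChernClassEq_hyperplaneBundle
  h := powMetric
  ricci_eq m _ := powMetric_ricci m

/-! ### Taylor coefficients of entire functions of two variables -/

section Taylor

/-- The Taylor coefficient at the origin of an entire function of one variable. -/
def taylorCoeff (φ : ℂ → ℂ) (l : ℕ) : ℂ := iteratedDeriv l φ 0 / l.factorial

lemma hasSum_taylorCoeff {φ : ℂ → ℂ} (hφ : Differentiable ℂ φ) (z : ℂ) :
    HasSum (fun l => taylorCoeff φ l * z ^ l) (φ z) := by
  have e : (fun l => taylorCoeff φ l * z ^ l) =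
      fun l => ((l.factorial : ℂ))⁻¹ • (z - 0) ^ l • iteratedDeriv l φ 0 := by
    ext l
    simp only [taylorCoeff, sub_zero, smul_eq_mul]
    ring
  rw [e]
  exact Complex.hasSum_taylorSeries_of_entire hφ 0 z

lemma taylorCoeff_comp_mul_const {φ : ℂ → ℂ} (hφ : Differentiable ℂ φ) (c a : ℂ) (l : ℕ) :
    taylorCoeff (fun x => c * φ (x * a)) l = c * a ^ l * taylorCoeff φ l := by
  have h : ContDiff ℂ l fun x => φ (x * a) :=
    hφ.contDiff.comp (contDiff_id.mul contDiff_const)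
  have h2 := iteratedDeriv_comp_const_mul (n := l) (f := φ) hφ.contDiff a
  unfold taylorCoeff
  rw [iteratedDeriv_const_mul_field]
  simp only [mul_comm _ a]
  rw [h2]
  simp
  ring

/-- Cauchy's formula on the unit circle. -/
lemma integral_circle_eq_taylorCoeff {φ : ℂ → ℂ} (hφ : Differentiable ℂ φ) (l : ℕ) :
    ∫ θ in (0 : ℝ)..(2 * Real.pi), (starRingEnd ℂ) (Complex.exp (θ * Complex.I)) ^ l *
      φ (Complex.exp (θ * Complex.I)) = 2 * Real.pi * taylorCoeff φ l := by
  have h := DifferentiableOn.circleIntegral_one_div_sub_center_pow_smul (c := 0) zero_lt_one l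
    hφ.differentiableOn
  rw [circleIntegral_def_Icc] at h
  rw [intervalIntegral.integral_of_le (by positivity), ← MeasureTheory.integral_Icc_eq_integral_Ioc]
  have hI : Complex.I ≠ 0 := Complex.I_ne_zero
  have h3 : ∀ θ : ℝ, deriv (circleMap 0 1) θ • (1 / (circleMap 0 1 θ - 0) ^ (l + 1)) •
      φ (circleMap 0 1 θ) = Complex.I * ((starRingEnd ℂ) (Complex.exp (θ * Complex.I)) ^ l *
      φ (Complex.exp (θ * Complex.I))) := by
    intro θ
    have he : Complex.exp (θ * Complex.I) ≠ 0 := Complex.exp_ne_zero _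
    have hc : (starRingEnd ℂ) (Complex.exp (θ * Complex.I)) = (Complex.exp (θ * Complex.I))⁻¹ := by
      rw [← Complex.exp_conj, ← Complex.exp_neg]
      simp
    simp only [deriv_circleMap, circleMap_zero, Complex.ofReal_one, one_mul, sub_zero, hc,
      smul_eq_mul, inv_pow, pow_succ]
    field_simp
  simp only [h3] at h
  rw [MeasureTheory.integral_const_mul] at h
  refine mul_left_cancel₀ hI (h.trans ?_)
  simp only [taylorCoeff, smul_eq_mul]
  ring

lemma taylorCoeff_eq_zero_of_growth {φ : ℂ → ℂ} (hφ : Differentiable ℂ φ) {C : ℝ} {N k : ℕ}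
    (hC : ∀ z, 1 ≤ ‖z‖ → ‖φ z‖ ≤ C * ‖z‖ ^ N) (hk : N < k) : taylorCoeff φ k = 0 := by
  have hb : ∀ R : ℝ, 1 ≤ R → ‖taylorCoeff φ k‖ ≤ C / R := by
    intro R hR
    have hR0 : 0 < R := by linarith
    have h := Complex.norm_iteratedDeriv_le_of_forall_mem_sphere_norm_le (f := φ) (c := 0)
      (C := C * R ^ N) k hR0 hφ.diffContOnCl (fun z hz => by
        have hz' : ‖z‖ = R := by simpa using hz
        rw [← hz']
        exact hC z (by rw [hz']; exact hR))
    have hC0 : 0 ≤ C := by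
      have := (norm_nonneg _).trans (hC 1 (by simp))
      simpa using this
    have hf : (0 : ℝ) < k.factorial := by positivity
    rw [taylorCoeff, norm_div, RCLike.norm_natCast, div_le_iff₀ hf]
    refine h.trans ?_
    obtain ⟨j, rfl⟩ := Nat.exists_eq_add_of_lt hk
    rw [pow_add, pow_add, pow_one]
    have hj : 1 ≤ R ^ j := one_le_pow₀ hR
    rw [div_mul_eq_mul_div, div_le_div_iff₀ (by positivity) hR0]
    have : 0 ≤ C * R ^ N * R * (N + j + 1).factorial := by positivity
    nlinarith
  -- the radius of the circle in Cauchy's estimate tends to infinity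
  have hlim : Filter.Tendsto (fun R : ℝ => C / R) Filter.atTop (𝓝 0) :=
    Filter.tendsto_id.const_div_atTop C
  have := ge_of_tendsto hlim ((Filter.eventually_ge_atTop 1).mono hb)
  exact norm_le_zero_iff.mp this

/-- The coefficient of `aˡ` in `f(a, b)`, as a function of `b`. -/
def sliceCoeff (f : ℂ × ℂ → ℂ) (l : ℕ) (b : ℂ) : ℂ := taylorCoeff (fun a => f (a, b)) l

/-- The `l`-th derivative in `a` at `0` is again the restriction of a holomorphic function of two
variables. -/
lemma differentiable_sliceCoeff {f : ℂ × ℂ → ℂ} (hf : ContDiff ℂ ω f) (l : ℕ) :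
    Differentiable ℂ (sliceCoeff f l) := by
  have key : ∀ l : ℕ, ∃ g : ℂ × ℂ → ℂ, ContDiff ℂ ω g ∧
      ∀ b, iteratedDeriv l (fun a => f (a, b)) = fun a => g (a, b) := by
    intro l
    induction l with
    | zero => exact ⟨f, hf, fun b => iteratedDeriv_zero⟩
    | succ l ih =>
      obtain ⟨g, hg, h⟩ := ih
      refine ⟨fun p => fderiv ℂ g p (1, 0),
        (hg.fderiv_right (m := ω) (by simp)).clm_apply contDiff_const, fun b => ?_⟩
      rw [iteratedDeriv_succ, h]
      ext a
      have h1 : HasDerivAt (fun a : ℂ => (a, b)) (1, 0) a :=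
        (hasDerivAt_id a).prodMk (hasDerivAt_const a b)
      exact ((hg.differentiable (by simp) (a, b)).hasFDerivAt.comp_hasDerivAt a h1).deriv
  obtain ⟨g, hg, h⟩ := key l
  have e : sliceCoeff f l = fun b => g (0, b) / l.factorial := by
    ext b
    rw [sliceCoeff, taylorCoeff, h]
  rw [e]
  have := hg.differentiable (by simp)
  fun_prop

lemma differentiable_slice {f : ℂ × ℂ → ℂ} (hf : ContDiff ℂ ω f) (b : ℂ) :
    Differentiable ℂ fun a => f (a, b) := by
  have := hf.differentiable (by simp)
  fun_prop

/-- The coefficient of `aˡ bᵏ` in `f(a, b)`. -/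
def coeff (f : ℂ × ℂ → ℂ) (l k : ℕ) : ℂ := taylorCoeff (sliceCoeff f l) k

variable {m : ℕ} {f₁ f₂ : ℂ × ℂ → ℂ}

lemma sliceCoeff_swap_eq (hf₁ : ContDiff ℂ ω f₁)
    (h : ∀ x y, x ≠ 0 → f₂ (x, y) = x ^ m * f₁ (x * y, x⁻¹)) (l : ℕ) {x : ℂ} (hx : x ≠ 0) :
    sliceCoeff (f₂ ∘ Prod.swap) l x = x ^ (l + m) * sliceCoeff f₁ l x⁻¹ := by
  have e : (fun y => (f₂ ∘ Prod.swap) (y, x)) = fun y => x ^ m * f₁ (y * x, x⁻¹) := by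
    ext y
    rw [mul_comm y x]
    exact h x y hx
  rw [sliceCoeff, e, taylorCoeff_comp_mul_const (φ := fun a => f₁ (a, x⁻¹))
    (differentiable_slice hf₁ _), sliceCoeff]
  ring

/-- The functions `f₁`, `f₂` are the expressions of a section of `𝒪(m)` in the two charts.  Since
`f₂` is bounded on compact sets, the coefficient of `aˡ` in `f₁` grows at most like `|b|^{l + m}`. -/
lemma coeff_eq_zero (hf₁ : ContDiff ℂ ω f₁) (hf₂ : ContDiff ℂ ω f₂)
    (h : ∀ x y, x ≠ 0 → f₂ (x, y) = x ^ m * f₁ (x * y, x⁻¹)) {l k : ℕ} (hk : l + m < k) :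
    coeff f₁ l k = 0 := by
  have hd := differentiable_sliceCoeff (hf₂.comp (contDiff_snd.prodMk contDiff_fst)) l
  obtain ⟨C, hC⟩ := (isCompact_closedBall (0 : ℂ) 1).exists_bound_of_continuousOn
    hd.continuous.continuousOn
  refine taylorCoeff_eq_zero_of_growth (differentiable_sliceCoeff hf₁ l) (C := C)
    (fun b hb => ?_) hk
  have hb0 : b ≠ 0 := by
    rintro rfl
    norm_num at hb
  have h1 := sliceCoeff_swap_eq hf₁ h l (inv_ne_zero hb0)
  have h2 : sliceCoeff f₁ l b = sliceCoeff (f₂ ∘ Prod.swap) l b⁻¹ * b ^ (l + m) := by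
    rw [h1, inv_inv, inv_pow]
    field_simp
  rw [h2, norm_mul, norm_pow]
  refine mul_le_mul_of_nonneg_right (hC _ ?_) (by positivity)
  simpa using inv_le_one_of_one_le₀ hb

lemma sliceCoeff_eq_sum (hf₁ : ContDiff ℂ ω f₁) (hf₂ : ContDiff ℂ ω f₂)
    (h : ∀ x y, x ≠ 0 → f₂ (x, y) = x ^ m * f₁ (x * y, x⁻¹)) (l : ℕ) (b : ℂ) :
    sliceCoeff f₁ l b = ∑ k ∈ Finset.range (l + m + 1), coeff f₁ l k * b ^ k := by
  refine (hasSum_taylorCoeff (differentiable_sliceCoeff hf₁ l) b).unique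
    (hasSum_sum_of_ne_finset_zero fun k hk => ?_)
  rw [Finset.mem_range, not_lt] at hk
  exact mul_eq_zero_of_left (coeff_eq_zero hf₁ hf₂ h hk) _

lemma hasSum_coeff_fst (hf₁ : ContDiff ℂ ω f₁) (hf₂ : ContDiff ℂ ω f₂)
    (h : ∀ x y, x ≠ 0 → f₂ (x, y) = x ^ m * f₁ (x * y, x⁻¹)) (w : ℂ × ℂ) :
    HasSum (fun l => ∑ k ∈ Finset.range (l + m + 1), coeff f₁ l k * (w.1 ^ l * w.2 ^ k))
      (f₁ w) := by
  convert hasSum_taylorCoeff (differentiable_slice hf₁ w.2) w.1 using 2 with l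
  change _ = sliceCoeff f₁ l w.2 * w.1 ^ l
  rw [sliceCoeff_eq_sum hf₁ hf₂ h, Finset.sum_mul]
  exact Finset.sum_congr rfl fun k _ => by ring

/-- The expansion in the second chart follows from the transition formula where `x ≠ 0`, and at
`x = 0` by continuity. -/
lemma hasSum_coeff_snd (hf₁ : ContDiff ℂ ω f₁) (hf₂ : ContDiff ℂ ω f₂)
    (h : ∀ x y, x ≠ 0 → f₂ (x, y) = x ^ m * f₁ (x * y, x⁻¹)) (w : ℂ × ℂ) :
    HasSum (fun l => ∑ k ∈ Finset.range (l + m + 1),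
      coeff f₁ l k * (w.2 ^ l * w.1 ^ (l + m - k))) (f₂ w) := by
  have hs : ContDiff ℂ ω (f₂ ∘ Prod.swap) := hf₂.comp (contDiff_snd.prodMk contDiff_fst)
  have key : ∀ l, (fun x => sliceCoeff (f₂ ∘ Prod.swap) l x) =
      fun x => ∑ k ∈ Finset.range (l + m + 1), coeff f₁ l k * x ^ (l + m - k) := by
    intro l
    refine Continuous.ext_on (dense_compl_singleton (0 : ℂ))
      (differentiable_sliceCoeff hs l).continuous (by fun_prop) fun x hx => ?_
    have hx0 : x ≠ 0 := hx
    rw [sliceCoeff_swap_eq hf₁ h l hx0, sliceCoeff_eq_sum hf₁ hf₂ h, Finset.mul_sum]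
    refine Finset.sum_congr rfl fun k hk => ?_
    have hk' : k ≤ l + m := by
      rw [Finset.mem_range] at hk
      omega
    rw [pow_sub₀ x hx0 hk', inv_pow]
    ring
  have e := hasSum_taylorCoeff (differentiable_slice hs w.1) w.2
  change HasSum _ (f₂ w) at e
  convert e using 2 with l
  change _ = sliceCoeff (f₂ ∘ Prod.swap) l w.1 * w.2 ^ l
  rw [congrFun (key l) w.1, Finset.sum_mul]
  exact Finset.sum_congr rfl fun k _ => by ring

end Taylor

open MeasureTheory

/-! ### Norms of monomials -/

section Integrals

lemma lintegral_pow_mul_exp_neg (n : ℕ) {c : ℝ} (hc : 0 < c) :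
    ∫⁻ s in Set.Ioi (0 : ℝ), ENNReal.ofReal (s ^ n * Real.exp (-(c * s))) =
      ENNReal.ofReal (n.factorial / c ^ (n + 1)) := by
  have h := Real.integral_rpow_mul_exp_neg_mul_Ioi (a := n + 1) (by positivity) hc
  have e : (1 / c) ^ ((n : ℝ) + 1) * Real.Gamma (n + 1) = n.factorial / c ^ (n + 1) := by
    rw [Real.Gamma_nat_eq_factorial]
    norm_cast
    simp
    ring
  simp only [add_sub_cancel_right, Real.rpow_natCast, e] at h
  -- a nonzero Bochner integral certifies integrability
  have hi : IntegrableOn (fun s : ℝ => s ^ n * Real.exp (-(c * s))) (Set.Ioi 0) :=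
    .of_integral_ne_zero (by rw [h]; positivity)
  rw [← ofReal_integral_eq_lintegral_ofReal hi, h]
  filter_upwards [ae_restrict_mem measurableSet_Ioi] with s hs
  have : 0 < s := hs
  positivity

lemma lintegral_normSq_pow_mul_exp_neg (p : ℕ) {c : ℝ} (hc : 0 < c) :
    ∫⁻ z : ℂ, ENNReal.ofReal (Complex.normSq z ^ p * Real.exp (-(c * Complex.normSq z))) =
      ENNReal.ofReal (Real.pi * (p.factorial / c ^ (p + 1))) := by
  have h := Complex.integral_rpow_mul_exp_neg_mul_rpow (p := 2) (q := 2 * p) (b := c)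
    (by norm_num) (by have : (0 : ℝ) ≤ p := by positivity
                      linarith) hc
  have e : (fun z : ℂ => ‖z‖ ^ (2 * (p : ℝ)) * Real.exp (-c * ‖z‖ ^ (2 : ℝ))) =
      fun z => Complex.normSq z ^ p * Real.exp (-(c * Complex.normSq z)) := by
    ext z
    rw [Real.rpow_mul (norm_nonneg z), Real.rpow_natCast]
    norm_cast
    rw [Complex.normSq_eq_norm_sq, neg_mul]
  have e2 : 2 * Real.pi / 2 * c ^ (-(2 * (p : ℝ) + 2) / 2) * Real.Gamma ((2 * p + 2) / 2) =
      Real.pi * (p.factorial / c ^ (p + 1)) := by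
    have h1 : -(2 * (p : ℝ) + 2) / 2 = -((p + 1 : ℕ) : ℝ) := by push_cast; ring
    have h2 : (2 * (p : ℝ) + 2) / 2 = p + 1 := by ring
    rw [h1, h2, Real.Gamma_nat_eq_factorial, Real.rpow_neg hc.le, Real.rpow_natCast]
    ring
  rw [e, e2] at h
  have hi : Integrable (fun z : ℂ => Complex.normSq z ^ p * Real.exp (-(c * Complex.normSq z))) :=
    .of_integral_ne_zero (by rw [h]; positivity)
  rw [← ofReal_integral_eq_lintegral_ofReal hi, h]
  exact .of_forall fun z => mul_nonneg (pow_nonneg (Complex.normSq_nonneg z) _) (Real.exp_pos _).le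

/-- A Beta integral.  It follows by Tonelli's theorem from the Gamma integral
`(N + 1)! / (1 + |z|²)^{N + 2} = ∫ s^{N + 1} e^{-(1 + |z|²) s} ds`. -/
lemma lintegral_normSq_pow_div {k N : ℕ} (hk : k ≤ N) :
    ∫⁻ z : ℂ, ENNReal.ofReal (Complex.normSq z ^ k / (1 + Complex.normSq z) ^ (N + 2)) =
      ENNReal.ofReal (Real.pi * (k.factorial * (N - k).factorial / (N + 1).factorial)) := by
  have hN : (0 : ℝ) < (N + 1).factorial := by positivity
  have h1 : ∀ z : ℂ, ENNReal.ofReal (Complex.normSq z ^ k / (1 + Complex.normSq z) ^ (N + 2)) =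
      ENNReal.ofReal (1 / (N + 1).factorial) * ∫⁻ s in Set.Ioi (0 : ℝ), ENNReal.ofReal
        (Complex.normSq z ^ k * (s ^ (N + 1) * Real.exp (-((1 + Complex.normSq z) * s)))) := by
    intro z
    have hz := Complex.normSq_nonneg z
    simp only [ENNReal.ofReal_mul (pow_nonneg hz k)]
    rw [lintegral_const_mul' _ _ ENNReal.ofReal_ne_top,
      lintegral_pow_mul_exp_neg (N + 1) (one_add_normSq_pos z),
      ← ENNReal.ofReal_mul (by positivity), ← ENNReal.ofReal_mul (by positivity)]
    congr 1
    field_simp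
  simp only [h1]
  rw [lintegral_const_mul' _ _ ENNReal.ofReal_ne_top, lintegral_lintegral_swap (by
    refine Measurable.aemeasurable ?_
    have : Measurable Complex.normSq := Complex.continuous_normSq.measurable
    fun_prop)]
  have h2 : ∀ s ∈ Set.Ioi (0 : ℝ), ∫⁻ z : ℂ, ENNReal.ofReal
      (Complex.normSq z ^ k * (s ^ (N + 1) * Real.exp (-((1 + Complex.normSq z) * s)))) =
      ENNReal.ofReal (Real.pi * k.factorial) *
        ENNReal.ofReal (s ^ (N - k) * Real.exp (-(1 * s))) := by
    intro s hs
    have hs0 : 0 < s := hs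
    have e : ∀ z : ℂ, Complex.normSq z ^ k * (s ^ (N + 1) *
        Real.exp (-((1 + Complex.normSq z) * s))) = (s ^ (N + 1) * Real.exp (-s)) *
        (Complex.normSq z ^ k * Real.exp (-(s * Complex.normSq z))) := by
      intro z
      rw [show -((1 + Complex.normSq z) * s) = -s + -(s * Complex.normSq z) by ring, Real.exp_add]
      ring
    have hp : 0 ≤ s ^ (N + 1) * Real.exp (-s) := by positivity
    simp only [e, ENNReal.ofReal_mul hp]
    rw [lintegral_const_mul' _ _ ENNReal.ofReal_ne_top, lintegral_normSq_pow_mul_exp_neg k hs0,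
      ← ENNReal.ofReal_mul hp, ← ENNReal.ofReal_mul (by positivity)]
    congr 1
    obtain ⟨j, rfl⟩ := Nat.exists_eq_add_of_le hk
    rw [Nat.add_sub_cancel_left, one_mul, show k + j + 1 = j + (k + 1) by ring, pow_add s j]
    field_simp
  rw [setLIntegral_congr_fun measurableSet_Ioi h2, lintegral_const_mul' _ _ ENNReal.ofReal_ne_top,
    lintegral_pow_mul_exp_neg _ one_pos, ← ENNReal.ofReal_mul (by positivity),
    ← ENNReal.ofReal_mul (by positivity)]
  congr 1
  field_simp
  simp

/-- The density `h_m(t₁ᵐ, t₁ᵐ) ω_S² / 2!` with respect to Lebesgue measure in the first chart. -/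
def density (m : ℕ) (w : ℂ × ℂ) : ℝ :=
  Real.exp (-potential fstL sndL w) ^ m *
    ((1 / Real.pi ^ 2) * (Complex.normSq w.1 + 1 / (1 + Complex.normSq w.2)))

lemma exp_neg_potential (w : ℂ × ℂ) : Real.exp (-potential fstL sndL w) =
    Real.exp (-((1 + Complex.normSq w.2) * Complex.normSq w.1)) / (1 + Complex.normSq w.2) := by
  have e : -potential fstL sndL w = -((1 + Complex.normSq w.2) * Complex.normSq w.1) -
      Real.log (1 + Complex.normSq w.2) := by
    simp only [potential, Complex.normSq_mul, ContinuousLinearMap.coe_fst',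
      ContinuousLinearMap.coe_snd']
    ring
  rw [e, Real.exp_sub, Real.exp_log (one_add_normSq_pos _)]

lemma density_nonneg (m : ℕ) (w : ℂ × ℂ) : 0 ≤ density m w := by
  have h1 := Complex.normSq_nonneg w.1
  have h2 := Complex.normSq_nonneg w.2
  unfold density
  positivity

lemma continuous_density (m : ℕ) : Continuous (density m) := by
  have h1 := (contDiff_potential (n := 0) fstL sndL).continuous
  have h2 := Complex.continuous_normSq
  unfold density
  refine (by fun_prop : Continuous _).mul (continuous_const.mul (Continuous.add (by fun_prop)
    (continuous_const.div (by fun_prop) fun w => (one_add_normSq_pos w.2).ne')))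

/-- The squared norm of the section `aˡ bᵏ` of `𝒪(m)`, for `k ≤ l + m`. -/
def monomialNormSq (m l k : ℕ) : ℝ :=
  l.factorial * k.factorial * (l + m - k).factorial / ((l + m).factorial * m ^ (l + 2))

lemma lintegral_monomial {m : ℕ} (hm : 1 ≤ m) {l k : ℕ} (hk : k ≤ l + m) :
    ∫⁻ w : ℂ × ℂ, ENNReal.ofReal (Complex.normSq (w.1 ^ l * w.2 ^ k) * density m w) =
      ENNReal.ofReal (monomialNormSq m l k) := by
  have hm0 : (0 : ℝ) < m := by exact_mod_cast hm
  have hmeas : Measurable fun w : ℂ × ℂ =>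
      ENNReal.ofReal (Complex.normSq (w.1 ^ l * w.2 ^ k) * density m w) := by
    have h1 := (continuous_density m).measurable
    have h2 : Measurable Complex.normSq := Complex.continuous_normSq.measurable
    fun_prop
  rw [Measure.volume_eq_prod, lintegral_prod_symm' _ hmeas]
  have inner : ∀ b : ℂ, ∫⁻ a : ℂ,
      ENNReal.ofReal (Complex.normSq (a ^ l * b ^ k) * density m (a, b)) =
      ENNReal.ofReal (l.factorial * (l + m + 1) / (Real.pi * m ^ (l + 2))) *
        ENNReal.ofReal (Complex.normSq b ^ k / (1 + Complex.normSq b) ^ (l + m + 2)) := by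
    intro b
    have hb := Complex.normSq_nonneg b
    have hb1 := one_add_normSq_pos b
    have hc : 0 < m * (1 + Complex.normSq b) := by positivity
    have hK : 0 ≤ Complex.normSq b ^ k / (1 + Complex.normSq b) ^ m * (1 / Real.pi ^ 2) := by
      positivity
    have e : ∀ a : ℂ, Complex.normSq (a ^ l * b ^ k) * density m (a, b) =
        Complex.normSq b ^ k / (1 + Complex.normSq b) ^ m * (1 / Real.pi ^ 2) *
        (Complex.normSq a ^ (l + 1) *
            Real.exp (-(m * (1 + Complex.normSq b) * Complex.normSq a)) +
          1 / (1 + Complex.normSq b) * (Complex.normSq a ^ l *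
            Real.exp (-(m * (1 + Complex.normSq b) * Complex.normSq a)))) := by
      intro a
      unfold density
      rw [exp_neg_potential, div_pow, ← Real.exp_nat_mul, map_mul, map_pow, map_pow,
        show (m : ℝ) * -((1 + Complex.normSq b) * Complex.normSq a) =
          -(m * (1 + Complex.normSq b) * Complex.normSq a) by ring]
      field_simp
      ring
    have hn : ∀ (n : ℕ) (a : ℂ), 0 ≤ Complex.normSq a ^ n *
        Real.exp (-(m * (1 + Complex.normSq b) * Complex.normSq a)) := fun n a =>
      mul_nonneg (pow_nonneg (Complex.normSq_nonneg a) n) (Real.exp_pos _).le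
    have h1b : 0 ≤ 1 / (1 + Complex.normSq b) := by positivity
    simp only [e, ENNReal.ofReal_mul hK, ENNReal.ofReal_add (hn _ _) (mul_nonneg h1b (hn _ _)),
      ENNReal.ofReal_mul h1b]
    rw [lintegral_const_mul' _ _ ENNReal.ofReal_ne_top, lintegral_add_left (by
        have h2 : Measurable Complex.normSq := Complex.continuous_normSq.measurable
        fun_prop), lintegral_const_mul' _ _ ENNReal.ofReal_ne_top,
      lintegral_normSq_pow_mul_exp_neg _ hc, lintegral_normSq_pow_mul_exp_neg _ hc,
      ← ENNReal.ofReal_mul h1b, ← ENNReal.ofReal_add (by positivity) (by positivity),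
      ← ENNReal.ofReal_mul hK, ← ENNReal.ofReal_mul (by positivity)]
    congr 1
    rw [Nat.factorial_succ, mul_pow, mul_pow]
    push_cast
    generalize 1 + Complex.normSq b = D at hb1
    field_simp
    ring
  simp only [inner]
  rw [lintegral_const_mul' _ _ ENNReal.ofReal_ne_top, lintegral_normSq_pow_div hk,
    ← ENNReal.ofReal_mul (by positivity)]
  congr 1
  unfold monomialNormSq
  rw [Nat.factorial_succ (l + m)]
  push_cast
  field_simp

end Integrals

/-! ### Orthonormal families -/

section Hilbert

variable {H : Type*} [NormedAddCommGroup H] [InnerProductSpace ℂ H]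

lemma _root_.Orthonormal.summable_smul [CompleteSpace H] {ι : Type*} {e : ι → H}
    (he : Orthonormal ℂ e) {c : ι → ℂ}
    (hc : Summable fun i => ‖c i‖ ^ 2) : Summable fun i => c i • e i := by
  have := (he.orthogonalFamily.summable_iff_norm_sq_summable c).mpr hc
  simpa using this

lemma _root_.HasSum.inner_const {ι : Type*} {f : ι → H} {x : H} (h : HasSum f x) (y : H) :
    HasSum (fun i => inner ℂ (f i) y) (inner ℂ x y) := by
  have h2 := (h.mapL (innerSL ℂ y)).star
  simpa only [innerSL_apply_apply, RCLike.star_def, inner_conj_symm] using h2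

/-- Parseval's identity for an element of the closed span of an orthonormal family. -/
lemma _root_.Orthonormal.hasSum_norm_inner_sq [CompleteSpace H] {ι : Type*} {v : ι → H}
    (hv : Orthonormal ℂ v) {x : H} (hx : x ∈ (Submodule.span ℂ (Set.range v)).topologicalClosure) :
    HasSum (fun i => ‖inner ℂ (v i) x‖ ^ 2) (‖x‖ ^ 2) := by
  set K := (Submodule.span ℂ (Set.range v)).topologicalClosure with hK
  have hmem : ∀ i, v i ∈ K := fun i =>
    Submodule.le_topologicalClosure _ (Submodule.subset_span ⟨i, rfl⟩)
  have : CompleteSpace K := (Submodule.isClosed_topologicalClosure _).completeSpace_coe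
  have hv' : Orthonormal ℂ fun i => (⟨v i, hmem i⟩ : K) := hv.codRestrict K hmem
  have hbot : (Submodule.span ℂ (Set.range fun i => (⟨v i, hmem i⟩ : K)))ᗮ = ⊥ := by
    rw [eq_bot_iff]
    intro y hy
    have h1 : ∀ i, inner ℂ (v i) (y : H) = 0 := fun i =>
      (Submodule.mem_orthogonal _ _).mp hy _ (Submodule.subset_span ⟨i, rfl⟩)
    have h2 : (y : H) ∈ Kᗮ := by
      have hK' : Kᗮ = (Submodule.span ℂ (Set.range v))ᗮ := Submodule.orthogonal_closure _
      rw [hK', Submodule.mem_orthogonal]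
      intro u hu
      induction hu using Submodule.span_induction with
      | mem u hu => obtain ⟨i, rfl⟩ := hu; exact h1 i
      | zero => simp
      | add a b _ _ ha hb => rw [inner_add_left, ha, hb, add_zero]
      | smul c a _ ha => rw [inner_smul_left, ha, mul_zero]
    have h3 : inner ℂ (y : H) (y : H) = 0 := (Submodule.mem_orthogonal _ _).mp h2 _ y.2
    rw [inner_self_eq_zero] at h3
    exact Subtype.ext h3
  have h := (HilbertBasis.mkOfOrthogonalEqBot hv' hbot).hasSum_inner_mul_inner ⟨x, hx⟩ ⟨x, hx⟩
  simp only [HilbertBasis.coe_mkOfOrthogonalEqBot, Submodule.coe_inner] at h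
  have h4 := Complex.hasSum_re h
  convert h4 using 1
  · ext i
    rw [← inner_conj_symm x (v i), mul_comm, Complex.mul_conj, Complex.ofReal_re,
      Complex.normSq_eq_norm_sq]
  · rw [inner_self_eq_norm_sq_to_K]
    norm_cast

end Hilbert

/-! ### Rotation invariance and Taylor coefficients as scalar products -/

section Rotations

/-- The measure `h_m(t₁ᵐ, t₁ᵐ) ω_S² / 2!` in the first chart. -/
def normMeasure (m : ℕ) : Measure (ℂ × ℂ) :=
  volume.withDensity fun w => ENNReal.ofReal (density m w)

lemma lintegral_normMeasure (m : ℕ) {g : ℂ × ℂ → ENNReal} (hg : Measurable g) :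
    ∫⁻ w, g w ∂normMeasure m = ∫⁻ w, g w * ENNReal.ofReal (density m w) := by
  have h := (continuous_density m).measurable.ennreal_ofReal
  rw [normMeasure, lintegral_withDensity_eq_lintegral_mul _ h hg]
  simp only [Pi.mul_apply, mul_comm]

instance (m : ℕ) : SFinite (normMeasure m) := by
  unfold normMeasure
  infer_instance

lemma measurePreserving_normMeasure {m : ℕ} {T : ℂ × ℂ → ℂ × ℂ}
    (hT : MeasurePreserving T) (hd : ∀ w, density m (T w) = density m w) :
    MeasurePreserving T (normMeasure m) (normMeasure m) := by
  refine ⟨hT.measurable, Measure.ext fun s hs => ?_⟩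
  have h := (continuous_density m).measurable.ennreal_ofReal
  rw [Measure.map_apply hT.measurable hs, normMeasure, withDensity_apply _ hs,
    withDensity_apply _ (hT.measurable hs), ← (hT.restrict_preimage hs).lintegral_comp h]
  simp only [hd]

lemma density_eq_of_normSq_eq {m : ℕ} {w w' : ℂ × ℂ} (h1 : Complex.normSq w'.1 = Complex.normSq w.1)
    (h2 : Complex.normSq w'.2 = Complex.normSq w.2) : density m w' = density m w := by
  unfold density
  rw [exp_neg_potential, exp_neg_potential, h1, h2]

lemma measurePreserving_mul_left (ζ : Circle) : MeasurePreserving fun z : ℂ => ζ * z :=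
  (rotation ζ).measurePreserving

lemma normSq_circle_mul (ζ : Circle) (z : ℂ) : Complex.normSq (ζ * z) = Complex.normSq z := by
  simp

lemma measurePreserving_rotate_fst (m : ℕ) (ζ : Circle) :
    MeasurePreserving (fun w : ℂ × ℂ => ((ζ : ℂ) * w.1, w.2)) (normMeasure m) (normMeasure m) :=
  measurePreserving_normMeasure ((measurePreserving_mul_left ζ).prod (MeasurePreserving.id _))
    fun _ => density_eq_of_normSq_eq (normSq_circle_mul ζ _) rfl

lemma measurePreserving_rotate_snd (m : ℕ) (ζ : Circle) :
    MeasurePreserving (fun w : ℂ × ℂ => (w.1, (ζ : ℂ) * w.2)) (normMeasure m) (normMeasure m) :=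
  measurePreserving_normMeasure ((MeasurePreserving.id _).prod (measurePreserving_mul_left ζ))
    fun _ => density_eq_of_normSq_eq rfl (normSq_circle_mul ζ _)

/-- Averaging an integrable function over a measure-preserving action of the circle does not change
its integral. -/
lemma integral_eq_integral_average {X : Type*} [TopologicalSpace X] [MeasurableSpace X]
    [BorelSpace X] [SecondCountableTopology X] {μ : Measure X} [SFinite μ] {T : Circle → X → X}
    (hT : Continuous (Function.uncurry T)) (hμ : ∀ ζ, MeasurePreserving (T ζ) μ μ) {G : X → ℂ}
    (hG : Continuous G) (hGi : Integrable G μ) :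
    Integrable (fun x => ∫ θ in (0 : ℝ)..(2 * Real.pi), G (T (Circle.exp θ) x)) μ ∧
      ∫ x, (∫ θ in (0 : ℝ)..(2 * Real.pi), G (T (Circle.exp θ) x)) ∂μ =
        2 * Real.pi * ∫ x, G x ∂μ := by
  have hpi : (0 : ℝ) ≤ 2 * Real.pi := by positivity
  simp only [intervalIntegral.integral_of_le hpi]
  have hc : Continuous fun p : ℝ × X => G (T (Circle.exp p.1) p.2) :=
    hG.comp (hT.comp ((Circle.exp.continuous.comp continuous_fst).prodMk continuous_snd))
  have hint : Integrable (fun p : ℝ × X => G (T (Circle.exp p.1) p.2))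
      ((volume.restrict (Set.Ioc 0 (2 * Real.pi))).prod μ) := by
    refine (integrable_prod_iff hc.aestronglyMeasurable).mpr
      ⟨.of_forall fun θ => (hμ (Circle.exp θ)).integrable_comp_of_integrable hGi, ?_⟩
    have : ∀ θ : ℝ, ∫ x, ‖G (T (Circle.exp θ) x)‖ ∂μ = ∫ x, ‖G x‖ ∂μ := fun θ => by
      have h := integral_map (μ := μ) (hμ (Circle.exp θ)).measurable.aemeasurable
        (f := fun x => ‖G x‖)
        hG.norm.aestronglyMeasurable
      rw [(hμ _).map_eq] at h
      exact h.symm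
    simp only [this]
    exact integrable_const _
  refine ⟨hint.integral_prod_right, ?_⟩
  rw [integral_integral_swap (f := fun x θ => G (T (Circle.exp θ) x)) hint.swap]
  have : ∀ θ : ℝ, ∫ x, G (T (Circle.exp θ) x) ∂μ = ∫ x, G x ∂μ := fun θ => by
    have h := integral_map (hμ (Circle.exp θ)).measurable.aemeasurable (f := G)
      (by rw [(hμ _).map_eq]; exact hG.aestronglyMeasurable)
    rw [(hμ _).map_eq] at h
    exact h.symm
  simp only [this]
  rw [integral_const]
  simp [hpi]

end Rotations

section Coefficients

lemma lintegral_normSq_monomial {m : ℕ} (hm : 1 ≤ m) {l k : ℕ} (hk : k ≤ l + m) :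
    ∫⁻ w, ENNReal.ofReal (Complex.normSq (w.1 ^ l * w.2 ^ k)) ∂normMeasure m =
      ENNReal.ofReal (monomialNormSq m l k) := by
  rw [← lintegral_monomial hm hk, lintegral_normMeasure]
  · simp only [ENNReal.ofReal_mul (Complex.normSq_nonneg _)]
  · have h2 := Complex.continuous_normSq
    exact (by fun_prop : Continuous fun w : ℂ × ℂ =>
      Complex.normSq (w.1 ^ l * w.2 ^ k)).measurable.ennreal_ofReal

lemma monomialNormSq_pos {m : ℕ} (hm : 1 ≤ m) (l k : ℕ) : 0 < monomialNormSq m l k := by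
  have hm0 : (0 : ℝ) < m := by exact_mod_cast hm
  unfold monomialNormSq
  positivity

lemma integral_normSq_monomial {m : ℕ} (hm : 1 ≤ m) {l k : ℕ} (hk : k ≤ l + m) :
    ∫ w, Complex.normSq (w.1 ^ l * w.2 ^ k) ∂normMeasure m = monomialNormSq m l k := by
  have h2 := Complex.continuous_normSq
  rw [integral_eq_lintegral_of_nonneg_ae (.of_forall fun _ => Complex.normSq_nonneg _)
    (by fun_prop : Continuous fun w : ℂ × ℂ =>
      Complex.normSq (w.1 ^ l * w.2 ^ k)).aestronglyMeasurable,
    lintegral_normSq_monomial hm hk, ENNReal.toReal_ofReal (monomialNormSq_pos hm l k).le]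

/-- The scalar product with a monomial reads off a Taylor coefficient: average over the rotations of
the first variable, then of the second. -/
lemma integral_conj_monomial_mul {m : ℕ} (hm : 1 ≤ m) {l k : ℕ} (hk : k ≤ l + m)
    {f : ℂ × ℂ → ℂ} (hf : ContDiff ℂ ω f)
    (hi : Integrable (fun w => (starRingEnd ℂ) (w.1 ^ l * w.2 ^ k) * f w) (normMeasure m)) :
    ∫ w, (starRingEnd ℂ) (w.1 ^ l * w.2 ^ k) * f w ∂normMeasure m =
      coeff f l k * monomialNormSq m l k := by
  have hpi : (2 * Real.pi : ℂ) ≠ 0 := by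
    have := Real.pi_ne_zero
    norm_cast
    positivity
  have hfc := hf.continuous
  have hconj := Complex.continuous_conj
  have hs := differentiable_sliceCoeff hf l
  have hsc := hs.continuous
  obtain ⟨hi1, h1⟩ := integral_eq_integral_average
    (T := fun (ζ : Circle) (w : ℂ × ℂ) => ((ζ : ℂ) * w.1, w.2))
    (by have : Continuous fun ζ : Circle => (ζ : ℂ) := continuous_induced_dom
        simp only [Function.uncurry_def]
        fun_prop) (measurePreserving_rotate_fst m) (by fun_prop) hi
  have e1 : ∀ w : ℂ × ℂ, ∫ θ in (0 : ℝ)..(2 * Real.pi), (starRingEnd ℂ)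
      (((Circle.exp θ : ℂ) * w.1) ^ l * w.2 ^ k) * f ((Circle.exp θ : ℂ) * w.1, w.2) =
      2 * Real.pi * ((starRingEnd ℂ) (w.1 ^ l * w.2 ^ k) * (w.1 ^ l * sliceCoeff f l w.2)) := by
    intro w
    have h := integral_circle_eq_taylorCoeff (φ := fun x => 1 * f (x * w.1, w.2))
      (by have := hf.differentiable (by simp)
          fun_prop) l
    rw [taylorCoeff_comp_mul_const (φ := fun a => f (a, w.2)) (differentiable_slice hf w.2)] at h
    have e : ∀ θ : ℝ, (starRingEnd ℂ) (((Circle.exp θ : ℂ) * w.1) ^ l * w.2 ^ k) *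
        f ((Circle.exp θ : ℂ) * w.1, w.2) = (starRingEnd ℂ) (w.1 ^ l * w.2 ^ k) *
        ((starRingEnd ℂ) (Complex.exp (θ * Complex.I)) ^ l *
          (1 * f (Complex.exp (θ * Complex.I) * w.1, w.2))) := by
      intro θ
      rw [Circle.coe_exp]
      simp only [map_mul, map_pow]
      ring
    simp only [e]
    rw [intervalIntegral.integral_const_mul, h, sliceCoeff]
    ring
  simp only [e1] at hi1 h1
  rw [integral_const_mul] at h1
  have hi2 := hi1.const_mul (2 * Real.pi : ℂ)⁻¹
  simp only [inv_mul_cancel_left₀ hpi] at hi2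
  obtain ⟨-, h3⟩ := integral_eq_integral_average
    (T := fun (ζ : Circle) (w : ℂ × ℂ) => (w.1, (ζ : ℂ) * w.2))
    (by have : Continuous fun ζ : Circle => (ζ : ℂ) := continuous_induced_dom
        simp only [Function.uncurry_def]
        fun_prop) (measurePreserving_rotate_snd m) (by fun_prop) hi2
  have e2 : ∀ w : ℂ × ℂ, ∫ θ in (0 : ℝ)..(2 * Real.pi), (starRingEnd ℂ)
      (w.1 ^ l * ((Circle.exp θ : ℂ) * w.2) ^ k) *
        (w.1 ^ l * sliceCoeff f l ((Circle.exp θ : ℂ) * w.2)) =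
      2 * Real.pi * (coeff f l k * (Complex.normSq (w.1 ^ l * w.2 ^ k) : ℝ)) := by
    intro w
    have h := integral_circle_eq_taylorCoeff (φ := fun x => 1 * sliceCoeff f l (x * w.2))
      (by fun_prop) k
    rw [taylorCoeff_comp_mul_const hs] at h
    have e : ∀ θ : ℝ, (starRingEnd ℂ) (w.1 ^ l * ((Circle.exp θ : ℂ) * w.2) ^ k) *
        (w.1 ^ l * sliceCoeff f l ((Circle.exp θ : ℂ) * w.2)) =
        ((starRingEnd ℂ) (w.1 ^ l * w.2 ^ k) * w.1 ^ l) *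
        ((starRingEnd ℂ) (Complex.exp (θ * Complex.I)) ^ k *
          (1 * sliceCoeff f l (Complex.exp (θ * Complex.I) * w.2))) := by
      intro θ
      rw [Circle.coe_exp]
      simp only [map_mul, map_pow]
      ring
    simp only [e]
    rw [intervalIntegral.integral_const_mul, h, coeff, ← Complex.mul_conj]
    ring
  simp only [e2] at h3
  rw [integral_const_mul] at h3
  rw [← mul_left_cancel₀ hpi h1, ← mul_left_cancel₀ hpi h3, integral_const_mul,
    integral_complex_ofReal, integral_normSq_monomial hm hk]

lemma taylorCoeff_pow_mul (n l : ℕ) (c : ℂ) :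
    taylorCoeff (fun a => a ^ n * c) l = if l = n then c else 0 := by
  rw [taylorCoeff, iteratedDeriv_mul_const_field, iteratedDeriv_pow]
  rcases lt_trichotomy l n with h | h | h
  · simp [h.ne, Nat.sub_ne_zero_of_lt h]
  · subst h
    have : (l.factorial : ℂ) ≠ 0 := by exact_mod_cast l.factorial_ne_zero
    simp [Nat.descFactorial_self, this]
  · simp [h.ne', Nat.descFactorial_of_lt h]

lemma coeff_monomial (l' k' l k : ℕ) :
    coeff (fun w => w.1 ^ l' * w.2 ^ k') l k = if l = l' ∧ k = k' then 1 else 0 := by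
  have h : sliceCoeff (fun w => w.1 ^ l' * w.2 ^ k') l =
      fun b => b ^ k' * if l = l' then 1 else 0 := by
    ext b
    refine (taylorCoeff_pow_mul l' l (b ^ k')).trans ?_
    split_ifs <;> simp
  rw [coeff, h, taylorCoeff_pow_mul]
  split_ifs <;> simp_all

end Coefficients

/-! ### Holomorphic sections of `𝒪(m)` -/

section Sections

variable {m : ℕ}

/-- The global holomorphic sections of `𝒪(m)`. -/
abbrev Sections (m : ℕ) : Type := (hyperplaneBundle.pow m).HolomorphicSection

/-- The value of a section at a point, in the preferred trivialization. -/
def eval (x : BlowUp) : Sections m →ₗ[ℂ] ℂ where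
  toFun s := val (s x)
  map_add' _ _ := rfl
  map_smul' _ _ := rfl

lemma localTriv_apply_snd (i : Bool) (x : BlowUp) (v : (hyperplaneBundle.pow m).Fiber x) :
    ((hyperplaneBundle.pow m).core.localTriv i ⟨x, v⟩).2 =
      (tc (index x) x / tc i x) ^ m * val v := by
  change (((tc (index x) x / tc i x) • ContinuousLinearMap.id ℂ ℂ) (1 : ℂ) ^ m •
    ContinuousLinearMap.id ℂ ℂ) (val v) = _
  simp

lemma contMDiffOn_section_iff (i : Bool) (s : ∀ x, (hyperplaneBundle.pow m).Fiber x) :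
    ContMDiffOn 𝓘(ℂ, ℂ × ℂ) (𝓘(ℂ, ℂ × ℂ).prod 𝓘(ℂ, ℂ)) ω
      (fun x => (⟨x, s x⟩ : Bundle.TotalSpace ℂ (hyperplaneBundle.pow m).core.Fiber))
      {x | tc i x ≠ 0} ↔
    ContMDiffOn 𝓘(ℂ, ℂ × ℂ) 𝓘(ℂ, ℂ) ω (fun x => (tc (index x) x / tc i x) ^ m * val (s x))
      {x | tc i x ≠ 0} := by
  have : (hyperplaneBundle.pow m).core.IsContMDiff 𝓘(ℂ, ℂ × ℂ) ω :=
    (hyperplaneBundle.pow m).holomorphic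
  simp only [← localTriv_apply_snd]
  have : MemTrivializationAtlas ((hyperplaneBundle.pow m).core.localTriv i) := ⟨⟨i, rfl⟩⟩
  exact Bundle.Trivialization.contMDiffOn_section_baseSet_iff
    ((hyperplaneBundle.pow m).core.localTriv i)

/-- The coefficient of a section with respect to the frame `tᵢᵐ`; only meaningful where `tᵢ ≠ 0`. -/
def frameCoord (i : Bool) (s : Sections m) (x : BlowUp) : ℂ :=
  (tc (index x) x / tc i x) ^ m * eval x s

lemma frameCoord_index (s : Sections m) (x : BlowUp) : frameCoord (index x) s x = eval x s := by
  rw [frameCoord, div_self (tc_index_ne_zero x), one_pow, one_mul]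

lemma contMDiffOn_frameCoord (i : Bool) (s : Sections m) :
    ContMDiffOn 𝓘(ℂ, ℂ × ℂ) 𝓘(ℂ, ℂ) ω (frameCoord i s) {x | tc i x ≠ 0} :=
  (contMDiffOn_section_iff i s).mp s.contMDiff.contMDiffOn

lemma contMDiff_chart_symm {e : OpenPartialHomeomorph BlowUp (ℂ × ℂ)}
    (he : e ∈ atlas (ℂ × ℂ) BlowUp) (ht : e.target = Set.univ) :
    ContMDiff 𝓘(ℂ, ℂ × ℂ) 𝓘(ℂ, ℂ × ℂ) ω e.symm := by
  have h := contMDiffOn_symm_of_mem_maximalAtlas (I := 𝓘(ℂ, ℂ × ℂ)) (n := ω)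
    (IsManifold.subset_maximalAtlas he)
  rwa [ht, contMDiffOn_univ] at h

/-- The function representing a section in the first chart -/
def repr₁ (s : Sections m) (w : ℂ × ℂ) : ℂ := frameCoord true s (param₁ w)

/-- The function representing a section in the second chart -/
def repr₂ (s : Sections m) (w : ℂ × ℂ) : ℂ := frameCoord false s (param₂ w)

lemma contDiff_repr₁ (s : Sections m) : ContDiff ℂ ω (repr₁ s) :=
  ((contMDiffOn_frameCoord true s).comp_contMDiff (contMDiff_chart_symm chart₁_mem_atlas rfl)
    t_param₁_fst_ne_zero).contDiff

lemma contDiff_repr₂ (s : Sections m) : ContDiff ℂ ω (repr₂ s) :=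
  ((contMDiffOn_frameCoord false s).comp_contMDiff (contMDiff_chart_symm chart₂_mem_atlas rfl)
    t_param₂_snd_ne_zero).contDiff

lemma index_param₁ (w : ℂ × ℂ) : index (param₁ w) = true := index_of_ne (t_param₁_fst_ne_zero w)

lemma repr₁_eq_eval (s : Sections m) (w : ℂ × ℂ) : repr₁ s w = eval (param₁ w) s := by
  rw [← frameCoord_index, index_param₁, repr₁]

lemma param₁_eq_param₂ {x : ℂ} (hx : x ≠ 0) (y : ℂ) : param₁ (x * y, x⁻¹) = param₂ (x, y) := by
  have h : (param₂ (x, y)).t.1 ≠ 0 := by rwa [Ne, t_param₂_fst_eq_zero_iff]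
  rw [← param₁_chart₁ h]
  congr 1
  refine Prod.ext rfl ?_
  rw [← inv_div, t_param₂_div]

lemma repr₂_eq (s : Sections m) (x y : ℂ) (hx : x ≠ 0) :
    repr₂ s (x, y) = x ^ m * repr₁ s (x * y, x⁻¹) := by
  have h : (param₂ (x, y)).t.1 ≠ 0 := by rwa [Ne, t_param₂_fst_eq_zero_iff]
  rw [repr₁_eq_eval, param₁_eq_param₂ hx, repr₂, frameCoord, index_of_ne h]
  congr 2
  exact t_param₂_div (x, y)

/-- A section from compatible functions on the two charts. -/
def ofRepr (f₁ f₂ : ℂ × ℂ → ℂ) (hf₁ : ContDiff ℂ ω f₁) (hf₂ : ContDiff ℂ ω f₂)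
    (h : ∀ x y, x ≠ 0 → f₂ (x, y) = x ^ m * f₁ (x * y, x⁻¹)) : Sections m :=
  ⟨fun x => (if index x then f₁ (chart₁ x) else f₂ (chart₂ x) : ℂ), by
    have h12 : ∀ x : BlowUp, x.t.1 ≠ 0 → x.t.2 ≠ 0 →
        f₂ (chart₂ x) = (x.t.1 / x.t.2) ^ m * f₁ (chart₁ x) := by
      intro x h1 h2
      have e : chart₁ x = (x.t.1 / x.t.2 * x.z.2, (x.t.1 / x.t.2)⁻¹) := by
        refine Prod.ext ?_ (inv_div _ _).symm
        change x.z.1 = x.t.1 / x.t.2 * x.z.2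
        field_simp
        linear_combination -x.incidence
      rw [e]
      exact h _ _ (div_ne_zero h1 h2)
    have key : ∀ i : Bool, ContMDiffOn 𝓘(ℂ, ℂ × ℂ) (𝓘(ℂ, ℂ × ℂ).prod 𝓘(ℂ, ℂ)) ω
        (fun x => (⟨x, (if index x then f₁ (chart₁ x) else f₂ (chart₂ x) : ℂ)⟩ :
          Bundle.TotalSpace ℂ (hyperplaneBundle.pow m).core.Fiber)) {x | tc i x ≠ 0} := by
      intro i
      refine (contMDiffOn_section_iff i _).mpr ?_
      cases i
      · refine (hf₂.contMDiff.comp_contMDiffOn (contMDiffOn_of_mem_maximalAtlas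
          (IsManifold.subset_maximalAtlas chart₂_mem_atlas))).congr fun x hx => ?_
        have hx2 : x.t.2 ≠ 0 := hx
        by_cases hx1 : x.t.1 = 0
        · rw [index_of_eq hx1]
          change (x.t.2 / x.t.2) ^ m * f₂ (chart₂ x) = f₂ (chart₂ x)
          rw [div_self hx2, one_pow, one_mul]
        · rw [index_of_ne hx1]
          exact (h12 x hx1 hx2).symm
      · refine (hf₁.contMDiff.comp_contMDiffOn (contMDiffOn_of_mem_maximalAtlas
          (IsManifold.subset_maximalAtlas chart₁_mem_atlas))).congr fun x hx => ?_
        have hx1 : x.t.1 ≠ 0 := hx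
        rw [index_of_ne hx1]
        change (x.t.1 / x.t.1) ^ m * f₁ (chart₁ x) = f₁ (chart₁ x)
        rw [div_self hx1, one_pow, one_mul]
    intro x
    exact (key (index x)).contMDiffAt ((isOpen_tc_ne _).mem_nhds (tc_index_ne_zero x))⟩

/-- The section of `𝒪(m)` given by `aˡ bᵏ` in the first chart `(a, b)`; in the second chart `(x, y)`
it is `yˡ x^{l + m - k}`. -/
def monomialSection (m l k : ℕ) (hk : k ≤ l + m) : Sections m :=
  ofRepr (fun w => w.1 ^ l * w.2 ^ k) (fun w => w.2 ^ l * w.1 ^ (l + m - k))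
    ((contDiff_fst.pow l).mul (contDiff_snd.pow k))
    ((contDiff_snd.pow l).mul (contDiff_fst.pow _)) fun x y hx => by
      simp only
      rw [pow_sub₀ x hx hk, inv_pow]
      ring

lemma eval_monomialSection_of_ne {l k : ℕ} (hk : k ≤ l + m) {x : BlowUp} (hx : x.t.1 ≠ 0) :
    eval x (monomialSection m l k hk) = x.z.1 ^ l * (x.t.2 / x.t.1) ^ k := by
  change (if index x = true then (chart₁ x).1 ^ l * (chart₁ x).2 ^ k else _ : ℂ) = _
  rw [if_pos (index_of_ne hx)]
  rfl

lemma eval_monomialSection_of_eq {l k : ℕ} (hk : k ≤ l + m) {x : BlowUp} (hx : x.t.1 = 0) :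
    eval x (monomialSection m l k hk) = x.z.2 ^ l * (x.t.1 / x.t.2) ^ (l + m - k) := by
  change (if index x = true then _ else (chart₂ x).2 ^ l * (chart₂ x).1 ^ (l + m - k) : ℂ) = _
  rw [if_neg (by simp [index_of_eq hx])]
  rfl

lemma repr₁_monomialSection {l k : ℕ} (hk : k ≤ l + m) :
    repr₁ (monomialSection m l k hk) = fun w => w.1 ^ l * w.2 ^ k := by
  ext w
  rw [repr₁_eq_eval, eval_monomialSection_of_ne hk (t_param₁_fst_ne_zero w), t_param₁_div]
  rfl

/-- The Taylor expansion of a section, valid at the points of both charts. -/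
lemma hasSum_eval (s : Sections m) (x : BlowUp) :
    HasSum (fun l => ∑ k : Fin (l + m + 1), coeff (repr₁ s) l k *
      eval x (monomialSection m l k (Nat.lt_succ_iff.mp k.2))) (eval x s) := by
  by_cases hx : x.t.1 = 0
  · have h := hasSum_coeff_snd (contDiff_repr₁ s) (contDiff_repr₂ s) (repr₂_eq s)
      (x.t.1 / x.t.2, x.z.2)
    rw [repr₂, param₂_chart₂ (t_snd_ne_zero hx), ← index_of_eq hx, frameCoord_index] at h
    simp only [← Fin.sum_univ_eq_sum_range
      (fun k => coeff (repr₁ s) _ k * (x.z.2 ^ _ * (x.t.1 / x.t.2) ^ (_ - k)))] at h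
    simpa only [eval_monomialSection_of_eq _ hx] using h
  · have h := hasSum_coeff_fst (contDiff_repr₁ s) (contDiff_repr₂ s) (repr₂_eq s)
      (x.z.1, x.t.2 / x.t.1)
    rw [repr₁_eq_eval, param₁_chart₁ hx] at h
    simp only [← Fin.sum_univ_eq_sum_range
      (fun k => coeff (repr₁ s) _ k * (x.z.1 ^ _ * (x.t.2 / x.t.1) ^ k))] at h
    simpa only [eval_monomialSection_of_ne _ hx] using h

/-- The series behind the constant `m²`: the sum over `k` is a binomial expansion, the sum over `l`
an exponential series.  The two charts correspond to `X = 1` and to `Y = 1`. -/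
lemma hasSum_kernel {m : ℕ} (hm : 1 ≤ m) (A X Y : ℝ) :
    HasSum (fun l => ∑ k : Fin (l + m + 1), A ^ l * (X ^ (l + m - k) * Y ^ (k : ℕ)) /
      monomialNormSq m l k) ((m : ℝ) ^ 2 * (X + Y) ^ m * Real.exp (m * A * (X + Y))) := by
  have hm0 : (m : ℝ) ≠ 0 := by
    have : m ≠ 0 := by omega
    exact_mod_cast this
  have h := (NormedSpace.expSeries_div_hasSum_exp (𝔸 := ℝ) (m * A * (X + Y))).mul_left
    ((m : ℝ) ^ 2 * (X + Y) ^ m)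
  rw [← Real.exp_eq_exp_ℝ] at h
  refine h.congr_fun fun l => ?_
  rw [Fin.sum_univ_eq_sum_range (fun k => A ^ l * (X ^ (l + m - k) * Y ^ k) /
    monomialNormSq m l k)]
  have e : (X + Y) ^ m * (m * A * (X + Y)) ^ l = (Y + X) ^ (l + m) * (m * A) ^ l := by
    rw [mul_pow, pow_add, add_comm X Y]
    ring
  rw [mul_assoc, mul_div_assoc', e, add_pow, Finset.sum_mul, Finset.sum_div, Finset.mul_sum]
  refine Finset.sum_congr rfl fun k hk => ?_
  have hk' : k ≤ l + m := by
    rw [Finset.mem_range] at hk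
    omega
  rw [Nat.cast_choose ℝ hk', monomialNormSq]
  field_simp
  ring

lemma weight_of_ne {x : BlowUp} (hx : x.t.1 ≠ 0) : weight x =
    (1 + Complex.normSq (x.t.2 / x.t.1))⁻¹ *
      Real.exp (-(Complex.normSq x.z.1 * (1 + Complex.normSq (x.t.2 / x.t.1)))) := by
  have e : kahlerPotential (index x) x =
      potential fstL sndL (x.z.1, x.t.2 / x.t.1) := by
    rw [index_of_ne hx, ← kahlerPotential₁_comp_param₁, Function.comp_apply, param₁_chart₁ hx]
    rfl
  rw [weight, e, exp_neg_potential]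
  simp only
  rw [mul_comm (Complex.normSq x.z.1), div_eq_inv_mul]

lemma weight_of_eq {x : BlowUp} (hx : x.t.1 = 0) :
    weight x = Real.exp (-Complex.normSq x.z.2) := by
  have h3 := x.incidence
  rw [hx, zero_mul, eq_comm] at h3
  have hz := (mul_eq_zero.mp h3).resolve_left (t_snd_ne_zero hx)
  have e : kahlerPotential (index x) x = Complex.normSq x.z.2 := by
    rw [index_of_eq hx]
    simp [kahlerPotential, kahlerPotential₂, normSqZ, hx, hz]
  rw [weight, e]

lemma weight_param₁ (w : ℂ × ℂ) : weight (param₁ w) = Real.exp (-potential fstL sndL w) := by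
  rw [weight, index_param₁, ← kahlerPotential₁_comp_param₁]
  rfl

/-- The Bergman kernel on the diagonal, in the preferred trivialization. -/
lemma hasSum_normSq_eval_div {m : ℕ} (hm : 1 ≤ m) (x : BlowUp) :
    HasSum (fun α : (l : ℕ) × Fin (l + m + 1) => Complex.normSq
      (eval x (monomialSection m α.1 α.2 (Nat.lt_succ_iff.mp α.2.2))) / monomialNormSq m α.1 α.2)
      ((m : ℝ) ^ 2 / weight x ^ m) := by
  have hnn : ∀ α : (l : ℕ) × Fin (l + m + 1), 0 ≤ Complex.normSq
      (eval x (monomialSection m α.1 α.2 (Nat.lt_succ_iff.mp α.2.2))) / monomialNormSq m α.1 α.2 :=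
    fun α => div_nonneg (Complex.normSq_nonneg _) (monomialNormSq_pos hm _ _).le
  have key : HasSum (fun l => ∑ k : Fin (l + m + 1), Complex.normSq
      (eval x (monomialSection m l k (Nat.lt_succ_iff.mp k.2))) / monomialNormSq m l k)
      ((m : ℝ) ^ 2 / weight x ^ m) := by
    by_cases hx : x.t.1 = 0
    · have h := hasSum_kernel hm (Complex.normSq x.z.2) (Complex.normSq (x.t.1 / x.t.2)) 1
      have hx0 : Complex.normSq (x.t.1 / x.t.2) = 0 := by simp [hx]
      convert h using 1
      · ext l
        refine Finset.sum_congr rfl fun k _ => ?_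
        rw [eval_monomialSection_of_eq _ hx]
        simp only [map_mul, map_pow, one_pow, mul_one]
      · rw [weight_of_eq hx, hx0, ← Real.exp_nat_mul, div_eq_mul_inv, ← Real.exp_neg]
        simp
    · have h := hasSum_kernel hm (Complex.normSq x.z.1) 1 (Complex.normSq (x.t.2 / x.t.1))
      convert h using 1
      · ext l
        refine Finset.sum_congr rfl fun k _ => ?_
        rw [eval_monomialSection_of_ne _ hx]
        simp only [map_mul, map_pow, one_pow, one_mul]
      · rw [weight_of_ne hx, mul_pow, ← Real.exp_nat_mul, inv_pow, div_eq_mul_inv, mul_inv, inv_inv,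
          ← Real.exp_neg]
        ring_nf
  have hs : Summable fun α : (l : ℕ) × Fin (l + m + 1) => Complex.normSq
      (eval x (monomialSection m α.1 α.2 (Nat.lt_succ_iff.mp α.2.2))) /
        monomialNormSq m α.1 α.2 := by
    refine (summable_sigma_of_nonneg hnn).mpr ⟨fun l => Summable.of_finite, ?_⟩
    simp only [tsum_fintype]
    exact key.summable
  have h2 := hs.hasSum.sigma fun l => hasSum_fintype _
  rw [← h2.unique key]
  exact hs.hasSum

end Sections

/-! ### Scalar products in the first chart -/

section Norms

lemma measurableEmbedding_param₁ : MeasurableEmbedding param₁ :=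
  (chart₁.symm.isOpenEmbedding (by rfl)).measurableEmbedding

lemma chart₁_ne_chart₂ : chart₁ ≠ chart₂ := by
  intro h
  have h1 : param₁ (0, 0) ∈ chart₁.source := t_param₁_fst_ne_zero (0, 0)
  rw [h] at h1
  exact h1 ((t_param₁_snd_eq_zero_iff (0, 0)).mpr rfl)

/-- Only the first chart contributes: the points whose preferred chart is the second one have
`t₁ = 0`, and form a null set. -/
lemma volumeMeasure_simancaForm : volumeMeasure simancaForm =
    Measure.map param₁ (volume.withDensity fun w => ENNReal.ofReal
      ((1 / Real.pi ^ 2) * (Complex.normSq w.1 + 1 / (1 + Complex.normSq w.2)))) := by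
  unfold volumeMeasure
  ext s hs
  rw [Measure.sum_apply _ hs, tsum_eq_single ⟨chart₁, chart₁_mem_atlas⟩]
  · have h1 : {w | w ∈ chart₁.target ∧ chartAt (ℂ × ℂ) (chart₁.symm w) = chart₁} = Set.univ :=
      Set.eq_univ_of_forall fun w => ⟨Set.mem_univ w, chartAt_of_ne (t_param₁_fst_ne_zero w)⟩
    simp only [h1, Measure.restrict_univ]
    have h2 : ∀ w, volumeDensity simancaForm (chart₁.symm w) =
      (1 / Real.pi ^ 2) * (Complex.normSq w.1 + 1 / (1 + Complex.normSq w.2)) :=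
      volumeDensity_simancaForm_param₁
    simp only [h2]
    rfl
  · rintro ⟨e, he⟩ hne
    obtain rfl : e = chart₂ := by
      rcases he with rfl | rfl
      · exact absurd rfl hne
      · rfl
    have h1 : {w | w ∈ chart₂.target ∧ chartAt (ℂ × ℂ) (chart₂.symm w) = chart₂} ⊆
        ({0} : Set ℂ) ×ˢ Set.univ := by
      rintro w ⟨-, hw⟩
      refine ⟨?_, Set.mem_univ _⟩
      by_contra h0
      have h3 : (param₂ w).t.1 ≠ 0 := by rwa [Ne, t_param₂_fst_eq_zero_iff]
      exact chart₁_ne_chart₂ ((chartAt_of_ne h3).symm.trans hw)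
    have h2 : (volume : Measure (ℂ × ℂ)) {w | w ∈ chart₂.target ∧
        chartAt (ℂ × ℂ) (chart₂.symm w) = chart₂} = 0 := by
      refine measure_mono_null h1 ?_
      rw [Measure.volume_eq_prod, Measure.prod_prod]
      simp
    simp [Measure.restrict_eq_zero.mpr h2]

variable {m : ℕ}

lemma powMetric_sq (s : Sections m) (x : BlowUp) :
    (powMetric m).sq (s x) = Complex.normSq (eval x s) * weight x ^ m :=
  HermitianMetric.ofWeight_sq _ _ _ _

lemma powMetric_form (s t : Sections m) (x : BlowUp) :
    (powMetric m).form x (s x) (t x) =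
      ((weight x ^ m : ℝ) : ℂ) * ((starRingEnd ℂ) (eval x s) * eval x t) := rfl

lemma sqNorm_eq (s : Sections m) : (powMetric m).sqNorm (volumeMeasure simancaForm) s =
    ∫⁻ w, ENNReal.ofReal (Complex.normSq (repr₁ s w)) ∂normMeasure m := by
  have hc := (contDiff_repr₁ s).continuous
  have hn := Complex.continuous_normSq
  have hp := (contDiff_potential (n := 0) fstL sndL).continuous
  have hd : Measurable fun w : ℂ × ℂ => ENNReal.ofReal
      ((1 / Real.pi ^ 2) * (Complex.normSq w.1 + 1 / (1 + Complex.normSq w.2))) := by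
    have := hn.measurable
    fun_prop
  rw [HermitianMetric.sqNorm, volumeMeasure_simancaForm,
    measurableEmbedding_param₁.lintegral_map, lintegral_normMeasure]
  · simp only [powMetric_sq, ← repr₁_eq_eval, weight_param₁]
    rw [lintegral_withDensity_eq_lintegral_mul _ hd]
    · refine lintegral_congr fun w => ?_
      have h1 := Complex.normSq_nonneg (repr₁ s w)
      simp only [Pi.mul_apply]
      rw [mul_comm, ← ENNReal.ofReal_mul (by positivity), ← ENNReal.ofReal_mul h1, density]
      congr 1
      ring
    · exact (by fun_prop : Continuous fun w => Complex.normSq (repr₁ s w) *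
        Real.exp (-potential fstL sndL w) ^ m).measurable.ennreal_ofReal
  · exact (by fun_prop : Continuous fun w => Complex.normSq (repr₁ s w)).measurable.ennreal_ofReal

lemma scalarProduct_eq (s t : Sections m) :
    (powMetric m).scalarProduct (volumeMeasure simancaForm) s t =
      ∫ w, (starRingEnd ℂ) (repr₁ s w) * repr₁ t w ∂normMeasure m := by
  have hn := Complex.continuous_normSq
  have hd : Measurable fun w : ℂ × ℂ => ENNReal.ofReal
      ((1 / Real.pi ^ 2) * (Complex.normSq w.1 + 1 / (1 + Complex.normSq w.2))) := by
    have := hn.measurable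
    fun_prop
  rw [HermitianMetric.scalarProduct, volumeMeasure_simancaForm,
    measurableEmbedding_param₁.integral_map, normMeasure,
    integral_withDensity_eq_integral_toReal_smul hd (.of_forall fun _ => ENNReal.ofReal_lt_top),
    integral_withDensity_eq_integral_toReal_smul
      (continuous_density m).measurable.ennreal_ofReal (.of_forall fun _ => ENNReal.ofReal_lt_top)]
  refine integral_congr_ae (.of_forall fun w => ?_)
  have h1 := Complex.normSq_nonneg w.1
  have h2 := Complex.normSq_nonneg w.2
  simp only [powMetric_form, ← repr₁_eq_eval, weight_param₁]
  rw [ENNReal.toReal_ofReal (by positivity), ENNReal.toReal_ofReal (density_nonneg m w), density,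
    Complex.real_smul, Complex.real_smul]
  push_cast
  ring

end Norms

/-! ### The Hilbert space of sections and the epsilon function -/

section HilbertSpace

variable (m : ℕ)

/-- The `L²` space of the first chart that contains the sections of `𝒪(m)` of finite norm. -/
abbrev L2 : Type := Lp ℂ 2 (normMeasure m)

variable {m}

lemma repr₁_add (s t : Sections m) : repr₁ (s + t) = repr₁ s + repr₁ t := by
  ext w
  simp [repr₁_eq_eval]

lemma repr₁_zero : repr₁ (0 : Sections m) = 0 := by
  ext w
  simp [repr₁_eq_eval]

lemma repr₁_smul (c : ℂ) (s : Sections m) : repr₁ (c • s) = c • repr₁ s := by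
  ext w
  simp [repr₁_eq_eval]

variable (m)

/-- The space of holomorphic sections of finite norm. -/
def finiteNorm : Submodule ℂ (Sections m) where
  carrier := {s | MemLp (repr₁ s) 2 (normMeasure m)}
  add_mem' {s t} hs ht := by
    rw [Set.mem_ofPred_eq, repr₁_add]
    exact hs.add ht
  zero_mem' := by
    rw [Set.mem_ofPred_eq, repr₁_zero]
    exact MemLp.zero
  smul_mem' c s hs := by
    rw [Set.mem_ofPred_eq, repr₁_smul]
    exact hs.const_smul c

variable {m}

lemma memLp_repr₁ (s : finiteNorm m) : MemLp (repr₁ s.1) 2 (normMeasure m) := s.2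

variable (m)

/-- The isometric embedding of the sections of finite norm into `L²`. -/
def toL2 : finiteNorm m →ₗ[ℂ] L2 m where
  toFun s := (memLp_repr₁ s).toLp
  map_add' s t := by
    rw [← MemLp.toLp_add]
    simp only [Submodule.coe_add, repr₁_add]
  map_smul' c s := by
    rw [RingHom.id_apply, ← MemLp.toLp_const_smul]
    simp only [Submodule.coe_smul, repr₁_smul]

variable {m}

lemma coeFn_toL2 (s : finiteNorm m) : toL2 m s =ᵐ[normMeasure m] repr₁ s.1 :=
  (memLp_repr₁ s).coeFn_toLp

lemma enorm_toL2_sq (s : finiteNorm m) :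
    ‖toL2 m s‖ₑ ^ 2 = (powMetric m).sqNorm (volumeMeasure simancaForm) s.1 := by
  rw [sqNorm_eq]
  change ‖(memLp_repr₁ s).toLp‖ₑ ^ 2 = _
  rw [Lp.enorm_toLp, eLpNorm_eq_lintegral_rpow_enorm_toReal (by norm_num) (by norm_num)]
  simp only [ENNReal.toReal_ofNat, one_div]
  rw [← ENNReal.rpow_natCast, ← ENNReal.rpow_mul]
  norm_num
  refine lintegral_congr fun w => ?_
  rw [Complex.normSq_eq_norm_sq, ENNReal.ofReal_pow (norm_nonneg _), ofReal_norm]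

lemma mem_finiteNorm_iff (s : Sections m) : s ∈ finiteNorm m ↔
    (powMetric m).sqNorm (volumeMeasure simancaForm) s < ⊤ := by
  constructor
  · intro hs
    rw [← enorm_toL2_sq ⟨s, hs⟩]
    exact ENNReal.pow_lt_top enorm_lt_top
  · intro hs
    rw [sqNorm_eq] at hs
    change MemLp (repr₁ s) 2 (normMeasure m)
    have hc := (contDiff_repr₁ s).continuous.aestronglyMeasurable (μ := normMeasure m)
    rw [memLp_two_iff_integrable_sq_norm hc]
    refine ⟨(hc.norm.pow 2), ?_⟩
    rw [hasFiniteIntegral_iff_ofReal (.of_forall fun w => by positivity)]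
    simpa only [Complex.normSq_eq_norm_sq] using hs

lemma inner_toL2 (s t : finiteNorm m) : inner ℂ (toL2 m s) (toL2 m t) =
    (powMetric m).scalarProduct (volumeMeasure simancaForm) s.1 t.1 := by
  rw [scalarProduct_eq, L2.inner_def]
  refine integral_congr_ae ?_
  filter_upwards [coeFn_toL2 s, coeFn_toL2 t] with w h1 h2
  rw [h1, h2]
  simp [mul_comm]

lemma integrable_conj_mul (s t : finiteNorm m) :
    Integrable (fun w => (starRingEnd ℂ) (repr₁ s.1 w) * repr₁ t.1 w) (normMeasure m) := by
  refine (L2.integrable_inner (𝕜 := ℂ) (toL2 m s) (toL2 m t)).congr ?_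
  filter_upwards [coeFn_toL2 s, coeFn_toL2 t] with w h1 h2
  rw [h1, h2]
  simp [mul_comm]

/-- The exponents `(l, k)` with `k ≤ l + m`. -/
abbrev MonomialIndex (m : ℕ) : Type := (l : ℕ) × Fin (l + m + 1)

/-- The monomial section with exponents `α`. -/
def monomial (α : MonomialIndex m) : Sections m :=
  monomialSection m α.1 α.2 (Nat.lt_succ_iff.mp α.2.2)

/-- The norm of a monomial section. -/
def monomialNorm (α : MonomialIndex m) : ℝ := √(monomialNormSq m α.1 α.2)

lemma monomialNorm_pos (hm : 1 ≤ m) (α : MonomialIndex m) : 0 < monomialNorm α :=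
  Real.sqrt_pos.mpr (monomialNormSq_pos hm _ _)

lemma monomialNorm_sq (hm : 1 ≤ m) (α : MonomialIndex m) :
    monomialNorm α ^ 2 = monomialNormSq m α.1 α.2 :=
  Real.sq_sqrt (monomialNormSq_pos hm _ _).le

lemma monomial_mem (hm : 1 ≤ m) (α : MonomialIndex m) : monomial α ∈ finiteNorm m := by
  rw [mem_finiteNorm_iff, sqNorm_eq, monomial, repr₁_monomialSection,
    lintegral_normSq_monomial hm (Nat.lt_succ_iff.mp α.2.2)]
  exact ENNReal.ofReal_lt_top

/-- The normalized monomial sections. -/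
def unitMonomial (hm : 1 ≤ m) (α : MonomialIndex m) : finiteNorm m :=
  ((monomialNorm α)⁻¹ : ℂ) • ⟨monomial α, monomial_mem hm α⟩

lemma inner_unitMonomial (hm : 1 ≤ m) (α : MonomialIndex m) (s : finiteNorm m) :
    inner ℂ (toL2 m (unitMonomial hm α)) (toL2 m s) =
      coeff (repr₁ s.1) α.1 α.2 * monomialNorm α := by
  have hk : (α.2 : ℕ) ≤ α.1 + m := Nat.lt_succ_iff.mp α.2.2
  have hi := integrable_conj_mul ⟨monomial α, monomial_mem hm α⟩ s
  simp only [monomial, repr₁_monomialSection] at hi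
  have h := integral_conj_monomial_mul hm hk (contDiff_repr₁ s.1) hi
  have hN : (monomialNorm α : ℂ) ≠ 0 := by
    exact_mod_cast (monomialNorm_pos hm α).ne'
  rw [unitMonomial, map_smul, inner_smul_left, inner_toL2, scalarProduct_eq]
  simp only [monomial, repr₁_monomialSection]
  rw [h, ← monomialNorm_sq hm]
  push_cast
  rw [map_inv₀, Complex.conj_ofReal]
  field_simp

lemma orthonormal_unitMonomial (hm : 1 ≤ m) :
    Orthonormal ℂ fun α => toL2 m (unitMonomial hm α) := by
  rw [orthonormal_iff_ite]
  intro α β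
  have hN : (monomialNorm β : ℂ) ≠ 0 := by
    exact_mod_cast (monomialNorm_pos hm β).ne'
  have h : inner ℂ (toL2 m (unitMonomial hm α)) (toL2 m (unitMonomial hm β)) =
      (monomialNorm β : ℂ)⁻¹ * ((if (α.1 : ℕ) = β.1 ∧ (α.2 : ℕ) = β.2 then 1 else 0) *
        monomialNorm α) := by
    conv_lhs => rw [unitMonomial.eq_def hm β, map_smul, inner_smul_right, inner_unitMonomial]
    simp only [monomial, repr₁_monomialSection, coeff_monomial]
  rw [h]
  by_cases hαβ : α = β
  · subst hαβ
    simp [hN]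
  · have : ¬((α.1 : ℕ) = β.1 ∧ (α.2 : ℕ) = β.2) := by
      rintro ⟨h1, h2⟩
      refine hαβ (Sigma.ext h1 ?_)
      exact (Fin.heq_ext_iff (by rw [h1])).mpr h2
    rw [if_neg this, if_neg hαβ]
    simp

lemma eval_unitMonomial (hm : 1 ≤ m) (α : MonomialIndex m) (x : BlowUp) :
    eval x (unitMonomial hm α).1 = (monomialNorm α : ℂ)⁻¹ * eval x (monomial α) := by
  simp [unitMonomial]

lemma hasSum_norm_eval_unitMonomial_sq (hm : 1 ≤ m) (x : BlowUp) :
    HasSum (fun α => ‖eval x (unitMonomial hm α).1‖ ^ 2) ((m : ℝ) ^ 2 / weight x ^ m) := by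
  refine (hasSum_normSq_eval_div hm x).congr_fun fun α => ?_
  rw [eval_unitMonomial, norm_mul, mul_pow, norm_inv, Complex.norm_real, inv_pow, Real.norm_eq_abs,
    sq_abs, monomialNorm_sq hm, ← Complex.normSq_eq_norm_sq, inv_mul_eq_div, monomial]

/-- The evaluation at `x` is the scalar product with `κ = ∑ conj(e_α(x)) e_α`, where `e_α` are the
normalized monomials.  Convergence of the Taylor series as an unconditional sum over the pairs of
exponents comes from convergence in `L²`. -/
lemma exists_kernel (hm : 1 ≤ m) (x : BlowUp) : ∃ κ : L2 m,
    HasSum (fun α => (starRingEnd ℂ) (eval x (unitMonomial hm α).1) •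
      toL2 m (unitMonomial hm α)) κ ∧ ∀ s : finiteNorm m, inner ℂ κ (toL2 m s) = eval x s.1 := by
  have hs := (orthonormal_unitMonomial hm).summable_smul
    (c := fun α => (starRingEnd ℂ) (eval x (unitMonomial hm α).1)) (by
      simpa using (hasSum_norm_eval_unitMonomial_sq hm x).summable)
  refine ⟨_, hs.hasSum, fun s => ?_⟩
  have h1 : HasSum (fun α => inner ℂ (toL2 m (unitMonomial hm α)) (toL2 m s) *
      eval x (unitMonomial hm α).1) (inner ℂ (∑' α, (starRingEnd ℂ)
        (eval x (unitMonomial hm α).1) • toL2 m (unitMonomial hm α)) (toL2 m s)) := by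
    simpa [inner_smul_left] using hs.hasSum.inner_const (toL2 m s)
  refine (h1.sigma fun l => hasSum_fintype _).unique ((hasSum_eval s.1 x).congr_fun fun l => ?_)
  refine Finset.sum_congr rfl fun k _ => ?_
  have hN : (monomialNorm (⟨l, k⟩ : MonomialIndex m) : ℂ) ≠ 0 := by
    exact_mod_cast (monomialNorm_pos hm _).ne'
  rw [inner_unitMonomial, eval_unitMonomial, monomial]
  field_simp

lemma hasSum_eval_mul_inner (hm : 1 ≤ m) (x : BlowUp) (s : finiteNorm m) :
    HasSum (fun α => inner ℂ (toL2 m (unitMonomial hm α)) (toL2 m s) *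
      eval x (unitMonomial hm α).1) (eval x s.1) := by
  obtain ⟨κ, h, hκ⟩ := exists_kernel hm x
  rw [← hκ]
  simpa [inner_smul_left, mul_comm] using h.inner_const (toL2 m s)

/-- The normalized monomials expand every section of finite norm in `L²`: the expansion converges in
`L²` to some `p`, hence almost everywhere to `p` along a subsequence, while it converges pointwise
to the section. -/
lemma hasSum_inner_smul_unitMonomial (hm : 1 ≤ m) (s : finiteNorm m) :
    HasSum (fun α => inner ℂ (toL2 m (unitMonomial hm α)) (toL2 m s) •
      toL2 m (unitMonomial hm α)) (toL2 m s) := by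
  have ho := orthonormal_unitMonomial hm
  obtain ⟨p, hp⟩ := ho.summable_smul (ho.inner_products_summable (toL2 m s))
  suffices h : p = toL2 m s by rwa [h] at hp
  have hmeas := tendstoInMeasure_of_tendsto_Lp hp
  obtain ⟨ns, hns, hae⟩ := hmeas.exists_seq_tendsto_ae'
  refine Lp.ext ?_
  set c : MonomialIndex m → ℂ := fun α => inner ℂ (toL2 m (unitMonomial hm α)) (toL2 m s)
  have hsum : ∀ F : Finset (MonomialIndex m), ∑ α ∈ F, c α • toL2 m (unitMonomial hm α) =
      toL2 m (∑ α ∈ F, c α • unitMonomial hm α) := fun F => by simp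
  have hall : ∀ᵐ w ∂normMeasure m, ∀ i : ℕ,
      (∑ α ∈ ns i, c α • toL2 m (unitMonomial hm α) : L2 m) w =
        repr₁ (∑ α ∈ ns i, c α • unitMonomial hm α : finiteNorm m).1 w := by
    refine ae_all_iff.mpr fun i => ?_
    rw [hsum]
    exact coeFn_toL2 _
  filter_upwards [hae, hall, coeFn_toL2 s] with w h1 h2 h3
  rw [h3]
  refine tendsto_nhds_unique h1 ?_
  have h4 := (hasSum_eval_mul_inner hm (param₁ w) s).comp hns
  rw [← repr₁_eq_eval] at h4
  refine h4.congr fun i => ?_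
  rw [h2, repr₁_eq_eval]
  simp [c]

lemma isOrthonormalBasis_unitMonomial (hm : 1 ≤ m) :
    (powMetric m).IsOrthonormalBasis (volumeMeasure simancaForm)
      fun α => (unitMonomial hm α).1 where
  sqNorm_lt_top α := (mem_finiteNorm_iff _).mp (unitMonomial hm α).2
  normalized α := by
    rw [← inner_toL2, inner_self_eq_norm_sq_to_K, (orthonormal_unitMonomial hm).1 α]
    simp
  orthogonal α β h := by
    rw [← inner_toL2]
    exact (orthonormal_unitMonomial hm).2 h
  dense t ht δ hδ := by
    have htm := (mem_finiteNorm_iff t).mpr ht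
    have h := hasSum_inner_smul_unitMonomial hm ⟨t, htm⟩
    set c : MonomialIndex m → ℂ := fun α => inner ℂ (toL2 m (unitMonomial hm α)) (toL2 m ⟨t, htm⟩)
    have h2 : Filter.Tendsto (fun F : Finset (MonomialIndex m) =>
        ‖toL2 m ⟨t, htm⟩ - ∑ α ∈ F, c α • toL2 m (unitMonomial hm α)‖ₑ ^ 2) Filter.atTop (𝓝 0) := by
      have h3 := ((tendsto_const_nhds (x := toL2 m ⟨t, htm⟩)).sub h).enorm
      have h4 := ((ENNReal.continuous_pow 2).tendsto _).comp h3
      rw [sub_self, enorm_zero, zero_pow two_ne_zero] at h4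
      exact h4
    obtain ⟨F, hF⟩ := (h2.eventually (gt_mem_nhds hδ)).exists
    refine ⟨(∑ α ∈ F, c α • unitMonomial hm α : finiteNorm m).1, ?_, ?_⟩
    · simp only [Submodule.coe_sum, Submodule.coe_smul]
      exact Submodule.sum_mem _ fun α _ =>
        Submodule.smul_mem _ _ (Submodule.subset_span ⟨α, rfl⟩)
    · have e := enorm_toL2_sq (⟨t, htm⟩ - ∑ α ∈ F, c α • unitMonomial hm α : finiteNorm m)
      rw [map_sub, map_sum] at e
      simp only [map_smul] at e
      exact e ▸ hF

/-- Parseval's identity for an orthonormal basis of sections and the vector `κ` representing the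
evaluation at `x`. -/
lemma hasSum_norm_eval_sq {J : Type} {s : J → Sections m}
    (hs : (powMetric m).IsOrthonormalBasis (volumeMeasure simancaForm) s)
    {κ : L2 m} (hκ : κ ∈ (LinearMap.range (toL2 m)).topologicalClosure) {x : BlowUp}
    (hev : ∀ s : finiteNorm m, inner ℂ κ (toL2 m s) = eval x s.1) :
    HasSum (fun j => ‖eval x (s j)‖ ^ 2) (‖κ‖ ^ 2) := by
  have hmem : ∀ j, s j ∈ finiteNorm m := fun j => (mem_finiteNorm_iff _).mpr (hs.sqNorm_lt_top j)
  set v : J → L2 m := fun j => toL2 m ⟨s j, hmem j⟩ with hv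
  have ho : Orthonormal ℂ v := by
    refine ⟨fun j => ?_, fun i j hij => ?_⟩
    · have h : inner ℂ (v j) (v j) = (1 : ℂ) := (inner_toL2 _ _).trans (hs.normalized j)
      have h2 : ‖v j‖ ^ 2 = 1 := by
        rw [← inner_self_eq_norm_sq (𝕜 := ℂ), h]
        simp
      exact (pow_eq_one_iff_of_nonneg (norm_nonneg _) two_ne_zero).mp h2
    · exact (inner_toL2 _ _).trans (hs.orthogonal i j hij)
  have hspan : ∀ u ∈ Submodule.span ℂ (Set.range s), ∃ hu : u ∈ finiteNorm m,
      toL2 m ⟨u, hu⟩ ∈ Submodule.span ℂ (Set.range v) := by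
    intro u hu
    induction hu using Submodule.span_induction with
    | mem u hu =>
      obtain ⟨j, rfl⟩ := hu
      exact ⟨hmem j, Submodule.subset_span ⟨j, rfl⟩⟩
    | zero => exact ⟨Submodule.zero_mem _, by
        have : toL2 m ⟨0, Submodule.zero_mem _⟩ = 0 := (toL2 m).map_zero
        rw [this]
        exact Submodule.zero_mem _⟩
    | add a b _ _ ha hb =>
      obtain ⟨ha, ha'⟩ := ha
      obtain ⟨hb, hb'⟩ := hb
      refine ⟨Submodule.add_mem _ ha hb, ?_⟩
      have : toL2 m ⟨a + b, Submodule.add_mem _ ha hb⟩ = toL2 m ⟨a, ha⟩ + toL2 m ⟨b, hb⟩ :=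
        (toL2 m).map_add ⟨a, ha⟩ ⟨b, hb⟩
      rw [this]
      exact Submodule.add_mem _ ha' hb'
    | smul c a _ ha =>
      obtain ⟨ha, ha'⟩ := ha
      refine ⟨Submodule.smul_mem _ c ha, ?_⟩
      have : toL2 m ⟨c • a, Submodule.smul_mem _ c ha⟩ = c • toL2 m ⟨a, ha⟩ :=
        (toL2 m).map_smul c ⟨a, ha⟩
      rw [this]
      exact Submodule.smul_mem _ c ha'
  have hle : LinearMap.range (toL2 m) ≤
      (Submodule.span ℂ (Set.range v)).topologicalClosure := by
    rintro _ ⟨t, rfl⟩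
    refine EMetric.mem_closure_iff.mpr fun ε hε => ?_
    obtain ⟨u, hu, hδ⟩ := hs.dense t.1 ((mem_finiteNorm_iff _).mp t.2) (ε ^ 2)
      (ENNReal.pow_pos hε 2)
    obtain ⟨hu', hu''⟩ := hspan u hu
    refine ⟨_, hu'', ?_⟩
    have e := enorm_toL2_sq (t - ⟨u, hu'⟩)
    rw [map_sub] at e
    rw [edist_eq_enorm_sub]
    exact lt_of_not_ge fun h => (pow_le_pow_left' h 2).not_gt (e.trans_lt hδ)
  have hκ' : κ ∈ (Submodule.span ℂ (Set.range v)).topologicalClosure :=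
    Submodule.topologicalClosure_minimal _ hle (Submodule.isClosed_topologicalClosure _) hκ
  refine (ho.hasSum_norm_inner_sq hκ').congr_fun fun j => ?_
  rw [norm_inner_symm, hev]

theorem hasEpsilonFunction (hm : 1 ≤ m) :
    simancaQuantization.HasEpsilonFunction m fun _ => (m : ℝ) ^ 2 := by
  refine ⟨⟨MonomialIndex m, _, isOrthonormalBasis_unitMonomial hm⟩, fun J s hs x => ?_⟩
  obtain ⟨κ, h, hκ⟩ := exists_kernel hm x
  have hmem : κ ∈ (LinearMap.range (toL2 m)).topologicalClosure :=
    mem_closure_of_tendsto h (.of_forall fun F => Submodule.sum_mem _ fun α _ =>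
      Submodule.smul_mem _ _ ⟨_, rfl⟩)
  have h1 := hasSum_norm_eval_sq (isOrthonormalBasis_unitMonomial hm) hmem hκ
  have h2 := hasSum_norm_eval_sq hs hmem hκ
  rw [h1.unique (hasSum_norm_eval_unitMonomial_sq hm x)] at h2
  have h3 := h2.mul_right (weight x ^ m)
  rw [div_mul_cancel₀ _ (pow_pos (weight_pos x) m).ne'] at h3
  refine h3.congr_fun fun j => ?_
  rw [← Complex.normSq_eq_norm_sq]
  exact powMetric_sq (s j) x

end HilbertSpace

end RegularQuantization

end

open RegularQuantization in
theorem theorem1 :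
    (IsKahlerForm simancaForm ∧
      ∀ x : BlowUp, x.z ≠ 0 →
        simancaForm x = ddbar (fun y => normSqZ y + Real.log (normSqZ y)) x) ∧
    ∃ Q : GeometricQuantization simancaForm,
      Q.IsRegular ∧ ∀ m : ℕ, 1 ≤ m → Q.HasEpsilonFunction m fun _ => (m : ℝ) ^ 2 := by
  refine ⟨⟨isKahlerForm_simancaForm, fun x hx => simancaForm_eq_ddbar_log hx⟩,
    simancaQuantization, ⟨0, fun m _ hm => ⟨(m : ℝ) ^ 2, ?_, hasEpsilonFunction hm⟩⟩,
    fun m hm => hasEpsilonFunction hm⟩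
  have : (0 : ℝ) < m := by exact_mod_cast hm
  positivity
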